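/- Let $G$ be a finitely generated group with at least three elements ($G$ may be infinite). Then the four free products $$G * G,\qquad G * \mathbb{Z},\qquad G * G * G,\qquad G * \mathbb{Z}/2\mathbb{Z}$$ are pairwise quasi-isometric. Here two finitely generated groups $\Gamma$ and $\Lambda$ are called quasi-isometric if, for all finite generating sets $S$ of $\Gamma$ and $T$ of $\Lambda$, with associated word metrics $d_S$ and $d_T$ (the path metrics of the Cayley graphs), there are a map $f\colon \Gamma\to\Lambda$ and constants $K\ge 1$, $C\ge 0$ such that $$K^{-1} d_S(x,y)-C\;\le\; d_T(f(x),f(y))\;\le\; K\, d_S(x,y)+C\qquad\text{for all } x,y\in \Gamma,$$ and every element of $\Lambda$ is at $d_T$-distance at most $C$ from some element of $f(\Gamma)$. (Since different finite generating sets give bilipschitz equivalent word metrics, it is equivalent to ask this for one choice of $S$ and $T$.) -/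

import Mathlib

/-- The map `f` between the vertex sets of the (connected) graphs `A` and `B`, equipped with their
path metrics (every edge has length one), is a quasi-isometry: it distorts distances by at most an
affine error, and its image is coarsely dense. -/
def IsGraphQuasiIsometry {V W : Type*} (A : SimpleGraph V) (B : SimpleGraph W) (f : V → W) :
    Prop :=
  ∃ K C : ℝ, 1 ≤ K ∧ 0 ≤ C ∧
    (∀ x y : V, K⁻¹ * (A.dist x y : ℝ) - C ≤ (B.dist (f x) (f y) : ℝ) ∧
      (B.dist (f x) (f y) : ℝ) ≤ K * (A.dist x y : ℝ) + C) ∧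
    ∀ w : W, ∃ x : V, (B.dist (f x) w : ℝ) ≤ C

/-- The groups `G` and `H` are finitely generated and quasi-isometric: for all finite generating
sets `S` of `G` and `T` of `H` there is a quasi-isometry from the Cayley graph of `(G, S)` to the
Cayley graph of `(H, T)`, that is, from `G` to `H` with respect to the word metrics. -/
def GroupsQuasiIsometric (G H : Type*) [Group G] [Group H] : Prop :=
  Group.FG G ∧ Group.FG H ∧
    ∀ (S : Finset G) (T : Finset H),
      Subgroup.closure (S : Set G) = ⊤ → Subgroup.closure (T : Set H) = ⊤ →
        ∃ f : G → H,
          IsGraphQuasiIsometry (SimpleGraph.mulCayley (S : Set G))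
            (SimpleGraph.mulCayley (T : Set H)) f

/-- The Cayley graph of a group with respect to a generating set is connected, so that its path
metric `SimpleGraph.dist` is a genuine metric. -/
theorem mulCayley_connected_of_closure_eq_top {G : Type*} [Group G] (S : Set G)
    (hS : Subgroup.closure S = ⊤) : (SimpleGraph.mulCayley S).Connected := by
  have step : ∀ a : G, ∀ g ∈ S, (SimpleGraph.mulCayley S).Reachable a (a * g) := by
    intro a g hg
    by_cases h : a = a * g
    · rw [← h]
    · exact SimpleGraph.Adj.reachable
        ((SimpleGraph.mulCayley_adj' S a (a * g)).2 ⟨h, g, hg, Or.inl rfl⟩)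
  have key : ∀ x ∈ Subgroup.closure S, ∀ a : G,
      (SimpleGraph.mulCayley S).Reachable a (a * x) := by
    intro x hx
    induction hx using Subgroup.closure_induction with
    | mem g hg => exact fun a => step a g hg
    | one => intro a; rw [mul_one]
    | mul x y _ _ hx hy => intro a; rw [← mul_assoc]; exact (hx a).trans (hy (a * x))
    | inv x _ hx => intro a; simpa using (hx (a * x⁻¹)).symm
  have : Nonempty G := ⟨1⟩
  refine ⟨fun a b => ?_⟩
  have := key (a⁻¹ * b) (by rw [hS]; trivial) a
  simpa using this

/-! A free product `G * H` is a tree of copies of the Cayley graph of `G`: the copies are the cosets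
of `G`, glued along the cosets of `H`. Replacing every coset of `H` by a rooted tree that is
coarsely `H` (a star if `H` is finite, a line if `H = ℤ`) turns each copy of `G` other than the root
into the child of exactly one copy, attached at a definite vertex of it (`freeProductTree`). The aim
is to show that up to quasi-isometry this tree of copies depends on `G` alone.

If `G` is infinite, each copy has, for every label `x ≠ 1` in `G`, at least one and at most `N`
children attached near `x`. Surplus siblings can be slid onto the first of them, into sites vacated
by pushing its own children a bounded distance away (`exists_sliding`). The result has exactly one
child per label, hence is the regular tree `wordGraph`. If `G` is finite, copies have bounded
diameter and may be shrunk to points; what remains is a tree with between two and `N` children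
everywhere, which refines to the binary tree (`exists_binary_refinement`). At least two children are
available because `G` has at least three elements.

This handles `G * ℤ` and `G * ℤ/2`, and also `G * ℤ/3`. Finally, `G * G` and `G * G * G` are the
kernels of the projections of `G * ℤ/2` and `G * ℤ/3` onto the finite factor, so they are
quasi-isometric to these groups (`hasCayleyGraphQuasiIsometricTo_of_conjugates`). -/

/-! ### Quasi-isometries of connected graphs. -/

/-- Two connected graphs are quasi-isometric if there are mutually coarsely inverse maps between
their vertex sets which stretch edges by a bounded amount. -/
def QuasiIsometricGraphs {V W : Type*} (A : SimpleGraph V) (B : SimpleGraph W) : Prop :=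
  A.Connected ∧ B.Connected ∧ ∃ (f : V → W) (g : W → V) (M : ℕ),
    (∀ x y, A.Adj x y → B.dist (f x) (f y) ≤ M) ∧ (∀ x y, B.Adj x y → A.dist (g x) (g y) ≤ M) ∧
    (∀ x, A.dist (g (f x)) x ≤ M) ∧ ∀ y, B.dist (f (g y)) y ≤ M

theorem dist_map_le_of_adj {V W : Type*} {A : SimpleGraph V} {B : SimpleGraph W}
    (hA : A.Connected) (hB : B.Connected) {f : V → W} {M : ℕ}
    (hf : ∀ x y, A.Adj x y → B.dist (f x) (f y) ≤ M) (x y : V) :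
    B.dist (f x) (f y) ≤ M * A.dist x y := by
  obtain ⟨p, hp⟩ := hA.exists_walk_length_eq_dist x y
  rw [← hp]
  clear hp
  induction p with
  | nil => simp
  | @cons u v w h p ih =>
    have h1 := hf _ _ h
    have h2 := hB.dist_triangle (u := f u) (v := f v) (w := f w)
    rw [SimpleGraph.Walk.length_cons]
    nlinarith

theorem QuasiIsometricGraphs.symm {V W : Type*} {A : SimpleGraph V} {B : SimpleGraph W}
    (h : QuasiIsometricGraphs A B) : QuasiIsometricGraphs B A := by
  obtain ⟨hA, hB, f, g, M, h1, h2, h3, h4⟩ := h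
  exact ⟨hB, hA, g, f, M, h2, h1, h4, h3⟩

theorem QuasiIsometricGraphs.trans {U V W : Type*} {A : SimpleGraph U} {B : SimpleGraph V}
    {C : SimpleGraph W} (h : QuasiIsometricGraphs A B) (h' : QuasiIsometricGraphs B C) :
    QuasiIsometricGraphs A C := by
  obtain ⟨hA, hB, f, g, M, h1, h2, h3, h4⟩ := h
  obtain ⟨-, hC, f', g', M', h1', h2', h3', h4'⟩ := h'
  refine ⟨hA, hC, f' ∘ f, g ∘ g', M' * M + M + M', ?_, ?_, ?_, ?_⟩
  · intro x y hxy
    have := dist_map_le_of_adj hB hC h1' (f x) (f y)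
    have := Nat.mul_le_mul_left M' (h1 x y hxy)
    simp only [Function.comp]
    omega
  · intro x y hxy
    have := dist_map_le_of_adj hB hA h2 (g' x) (g' y)
    have := Nat.mul_le_mul_left M (h2' x y hxy)
    have := Nat.mul_comm M M'
    simp only [Function.comp]
    omega
  · intro x
    have a := dist_map_le_of_adj hB hA h2 (g' (f' (f x))) (f x)
    have b := Nat.mul_le_mul_left M (h3' (f x))
    have c := hA.dist_triangle (u := g (g' (f' (f x)))) (v := g (f x)) (w := x)
    have d := h3 x
    have := Nat.mul_comm M M'
    simp only [Function.comp]
    omega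
  · intro y
    have a := dist_map_le_of_adj hB hC h1' (f (g (g' y))) (g' y)
    have b := Nat.mul_le_mul_left M' (h4 (g' y))
    have c := hC.dist_triangle (u := f' (f (g (g' y)))) (v := f' (g' y)) (w := y)
    have d := h4' y
    simp only [Function.comp]
    omega

theorem QuasiIsometricGraphs.exists_isGraphQuasiIsometry {V W : Type*} {A : SimpleGraph V}
    {B : SimpleGraph W} (h : QuasiIsometricGraphs A B) : ∃ f, IsGraphQuasiIsometry A B f := by
  obtain ⟨hA, hB, f, g, M, h1, h2, h3, h4⟩ := h
  refine ⟨f, M + 1, 2 * M, by simp, by positivity, fun x y => ⟨?_, ?_⟩, fun w => ⟨g w, ?_⟩⟩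
  · have a := hA.dist_triangle (u := x) (v := g (f x)) (w := y)
    have b := hA.dist_triangle (u := g (f x)) (v := g (f y)) (w := y)
    have c := dist_map_le_of_adj hB hA h2 (f x) (f y)
    have d := h3 x
    have e := h3 y
    rw [SimpleGraph.dist_comm] at d
    have key : (A.dist x y : ℝ) ≤ 2 * M + M * B.dist (f x) (f y) := by
      have : A.dist x y ≤ 2 * M + M * B.dist (f x) (f y) := by omega
      exact_mod_cast this
    have hM : (0 : ℝ) < M + 1 := by positivity
    rw [sub_le_iff_le_add, inv_mul_le_iff₀ hM]
    have h0 : (0 : ℝ) ≤ B.dist (f x) (f y) := by positivity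
    have h0' : (0 : ℝ) ≤ M := by positivity
    nlinarith
  · have c : (B.dist (f x) (f y) : ℝ) ≤ M * A.dist x y := by
      exact_mod_cast dist_map_le_of_adj hA hB h1 x y
    have h0 : (0 : ℝ) ≤ A.dist x y := by positivity
    have h0' : (0 : ℝ) ≤ M := by positivity
    nlinarith
  · have c : (B.dist (f (g w)) w : ℝ) ≤ M := by exact_mod_cast h4 w
    have h0' : (0 : ℝ) ≤ M := by positivity
    linarith

theorem dist_le_one_of_adj_or_eq {V : Type*} {A : SimpleGraph V} {x y : V}
    (h : A.Adj x y ∨ x = y) : A.dist x y ≤ 1 := by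
  rcases h with h | h
  · exact (SimpleGraph.dist_eq_one_iff_adj.2 h).le
  · simp [h]

/-- A map sending edges to edges or points is `1`-Lipschitz. -/
theorem dist_map_le {V W : Type*} {A : SimpleGraph V} {B : SimpleGraph W}
    (hA : A.Connected) (hB : B.Connected) {f : V → W}
    (hf : ∀ x y, A.Adj x y → B.Adj (f x) (f y) ∨ f x = f y) (x y : V) :
    B.dist (f x) (f y) ≤ A.dist x y := by
  simpa using dist_map_le_of_adj hA hB (M := 1)
    (fun x y h => dist_le_one_of_adj_or_eq (hf x y h)) x y

/-! ### Word metrics and change of generating set. -/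

section Cayley

variable {G : Type*} [Group G]

theorem mulCayley_adj_or_eq (S : Set G) (a s : G) (hs : s ∈ S) :
    (SimpleGraph.mulCayley S).Adj a (a * s) ∨ a = a * s := by
  by_cases h : a = a * s
  · exact Or.inr h
  · exact Or.inl ((SimpleGraph.mulCayley_adj' S a (a * s)).2 ⟨h, s, hs, Or.inl rfl⟩)

theorem mulCayley_dist_mul_left {S : Set G} (hS : Subgroup.closure S = ⊤) (a x y : G) :
    (SimpleGraph.mulCayley S).dist (a * x) (a * y) = (SimpleGraph.mulCayley S).dist x y := by
  have hc := mulCayley_connected_of_closure_eq_top S hS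
  have key : ∀ a x y : G, (SimpleGraph.mulCayley S).dist (a * x) (a * y) ≤
      (SimpleGraph.mulCayley S).dist x y := by
    intro a x y
    refine dist_map_le hc hc (f := fun x => a * x) (fun x y h => ?_) x y
    left
    rw [SimpleGraph.mulCayley_adj'] at h ⊢
    obtain ⟨h1, g, hg, h2⟩ := h
    refine ⟨by simpa using h1, g, hg, ?_⟩
    simpa [mul_assoc] using h2
  refine le_antisymm (key a x y) ?_
  simpa using key a⁻¹ (a * x) (a * y)

theorem mulCayley_adj_induction {S : Set G} {r : G → G → Prop} (hr : ∀ x y, r x y → r y x)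
    (h : ∀ a, ∀ s ∈ S, r a (a * s)) (x y : G) (hxy : (SimpleGraph.mulCayley S).Adj x y) :
    r x y := by
  rw [SimpleGraph.mulCayley_adj'] at hxy
  obtain ⟨-, g, hg, h' | h'⟩ := hxy
  · rw [← h']; exact h _ _ hg
  · rw [h']; exact hr _ _ (h _ _ hg)

theorem exists_mulCayley_dist_mul_le {S : Set G} (hS : Subgroup.closure S = ⊤) {F : Set G}
    (hF : F.Finite) :
    ∃ M, ∀ a, ∀ s ∈ F, (SimpleGraph.mulCayley S).dist a (a * s) ≤ M := by
  obtain ⟨M, hM⟩ := (hF.image (fun s => (SimpleGraph.mulCayley S).dist 1 s)).bddAbove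
  refine ⟨M, fun a s hs => ?_⟩
  have := mulCayley_dist_mul_left hS a 1 s
  rw [mul_one] at this
  rw [this]
  exact hM ⟨s, hs, rfl⟩

theorem quasiIsometricGraphs_mulCayley {S T : Set G} (hS : Subgroup.closure S = ⊤)
    (hT : Subgroup.closure T = ⊤) (hSf : S.Finite) (hTf : T.Finite) :
    QuasiIsometricGraphs (SimpleGraph.mulCayley S) (SimpleGraph.mulCayley T) := by
  obtain ⟨M, hM⟩ := exists_mulCayley_dist_mul_le hT hSf
  obtain ⟨M', hM'⟩ := exists_mulCayley_dist_mul_le hS hTf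
  refine ⟨mulCayley_connected_of_closure_eq_top S hS, mulCayley_connected_of_closure_eq_top T hT,
    id, id, max M M', ?_, ?_, by simp, by simp⟩
  · refine mulCayley_adj_induction (fun x y h => ?_) fun a s hs => (hM a s hs).trans (by simp)
    rwa [SimpleGraph.dist_comm]
  · refine mulCayley_adj_induction (fun x y h => ?_) fun a s hs => (hM' a s hs).trans (by simp)
    rwa [SimpleGraph.dist_comm]

end Cayley

/-- Groups with a finite generating set whose Cayley graph is quasi-isometric to a fixed graph are
quasi-isometric to each other. -/
def HasCayleyGraphQuasiIsometricTo (Γ : Type*) [Group Γ] {V : Type*} (X : SimpleGraph V) : Prop :=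
  ∃ S : Set Γ, S.Finite ∧ Subgroup.closure S = ⊤ ∧
    QuasiIsometricGraphs (SimpleGraph.mulCayley S) X

theorem HasCayleyGraphQuasiIsometricTo.trans {Γ : Type*} [Group Γ] {V W : Type*}
    {X : SimpleGraph V} {Y : SimpleGraph W} (h : HasCayleyGraphQuasiIsometricTo Γ X)
    (h' : QuasiIsometricGraphs X Y) : HasCayleyGraphQuasiIsometricTo Γ Y := by
  obtain ⟨S, h1, h2, h3⟩ := h
  exact ⟨S, h1, h2, h3.trans h'⟩

theorem HasCayleyGraphQuasiIsometricTo.groupsQuasiIsometric {Γ Λ : Type*} [Group Γ] [Group Λ]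
    {V : Type*} {X : SimpleGraph V} (h : HasCayleyGraphQuasiIsometricTo Γ X)
    (h' : HasCayleyGraphQuasiIsometricTo Λ X) : GroupsQuasiIsometric Γ Λ := by
  obtain ⟨S, hS, hS', hX⟩ := h
  obtain ⟨T, hT, hT', hX'⟩ := h'
  refine ⟨(Group.fg_iff).2 ⟨S, hS', hS⟩, (Group.fg_iff).2 ⟨T, hT', hT⟩, fun S₁ T₁ h1 h2 => ?_⟩
  exact (((quasiIsometricGraphs_mulCayley h1 hS' S₁.finite_toSet hS).trans hX).trans
    (hX'.symm.trans (quasiIsometricGraphs_mulCayley hT' h2 hT T₁.finite_toSet))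
    ).exists_isGraphQuasiIsometry

/-! ### Trees of copies of a graph. -/

/-- The tree of copies of the graph `P` indexed by `W`: the base point `b` of the copy `w` is joined
by an edge to the vertex `site w` of the copy `par w`. -/
def treeGraph {W P : Type*} (A : SimpleGraph P) (b : P) (par : W → W) (site : W → P) :
    SimpleGraph (W × P) :=
  SimpleGraph.fromRel fun x y =>
    (x.1 = y.1 ∧ A.Adj x.2 y.2) ∨ (x.2 = b ∧ y = (par x.1, site x.1))

section TreeGraph

variable {W P : Type*} {A : SimpleGraph P} {b : P} {par : W → W} {site : W → P}

theorem treeGraph_adj_fiber (w : W) {p q : P} (h : A.Adj p q) :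
    (treeGraph A b par site).Adj (w, p) (w, q) := by
  rw [treeGraph, SimpleGraph.fromRel_adj]
  exact ⟨fun e => h.ne (congrArg Prod.snd e), Or.inl (Or.inl ⟨rfl, h⟩)⟩

theorem treeGraph_adj_or_eq_parent (w : W) :
    (treeGraph A b par site).Adj (w, b) (par w, site w) ∨ (w, b) = (par w, site w) := by
  by_cases h : (w, b) = (par w, site w)
  · exact Or.inr h
  · left
    rw [treeGraph, SimpleGraph.fromRel_adj]
    exact ⟨h, Or.inl (Or.inr ⟨rfl, rfl⟩)⟩

theorem treeGraph_adj_induction {r : W × P → W × P → Prop} (hr : ∀ x y, r x y → r y x)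
    (h₁ : ∀ w p q, A.Adj p q → r (w, p) (w, q)) (h₂ : ∀ w, r (w, b) (par w, site w))
    (x y : W × P) (hxy : (treeGraph A b par site).Adj x y) : r x y := by
  rw [treeGraph, SimpleGraph.fromRel_adj] at hxy
  have key : ∀ x y : W × P, (x.1 = y.1 ∧ A.Adj x.2 y.2) ∨ (x.2 = b ∧ y = (par x.1, site x.1)) →
      r x y := by
    rintro ⟨w, p⟩ ⟨v, q⟩ (⟨h, h'⟩ | ⟨h, h'⟩)
    · simp only at h h'
      subst h
      exact h₁ _ _ _ h'
    · simp only at h h'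
      subst h
      rw [h']
      exact h₂ _
  rcases hxy.2 with h | h
  · exact key _ _ h
  · exact hr _ _ (key _ _ h)

theorem treeGraph_connected (hA : A.Connected) {o : W} {depth : W → ℕ}
    (hd : ∀ w, w ≠ o → depth (par w) < depth w) : (treeGraph A b par site).Connected := by
  have fib : ∀ w p q, (treeGraph A b par site).Reachable (w, p) (w, q) := by
    intro w p q
    obtain ⟨c⟩ := hA.preconnected p q
    induction c with
    | nil => rfl
    | cons h _ ih => exact (treeGraph_adj_fiber w h).reachable.trans ih
  have key : ∀ n w, depth w = n → (treeGraph A b par site).Reachable (w, b) (o, b) := by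
    intro n
    induction n using Nat.strong_induction_on with
    | _ n ih =>
      intro w hw
      by_cases h : w = o
      · rw [h]
      · have h1 := ih _ (hw ▸ hd w h) (par w) rfl
        refine SimpleGraph.Reachable.trans ?_ ((fib (par w) (site w) b).trans h1)
        rcases treeGraph_adj_or_eq_parent (A := A) (b := b) (par := par) (site := site) w with h | h
        · exact h.reachable
        · rw [← h]
  have : Nonempty (W × P) := ⟨(o, b)⟩
  refine ⟨fun x y => ?_⟩
  exact ((fib x.1 x.2 b).trans (key _ x.1 rfl)).trans
    ((fib y.1 y.2 b).trans (key _ y.1 rfl)).symm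

theorem treeGraph_dist_fiber_le (hA : A.Connected) (hT : (treeGraph A b par site).Connected)
    (w : W) (p q : P) : (treeGraph A b par site).dist (w, p) (w, q) ≤ A.dist p q :=
  dist_map_le hA hT (f := fun p => (w, p)) (fun _ _ h => Or.inl (treeGraph_adj_fiber w h)) p q

theorem treeGraph_dist_parent_le (w : W) :
    (treeGraph A b par site).dist (w, b) (par w, site w) ≤ 1 :=
  dist_le_one_of_adj_or_eq (treeGraph_adj_or_eq_parent w)

theorem treeGraph_dist_base_le (hA : A.Connected) (hT : (treeGraph A b par site).Connected)
    (w : W) (p : P) :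
    (treeGraph A b par site).dist (w, b) (par w, p) ≤ 1 + A.dist (site w) p :=
  hT.dist_triangle.trans (Nat.add_le_add (treeGraph_dist_parent_le w)
    (treeGraph_dist_fiber_le hA hT _ _ _))

/-- Attaching the same copies in two ways gives quasi-isometric trees of copies if each of the two
attaching edges joins vertices that are uniformly close in the other tree. -/
theorem quasiIsometricGraphs_treeGraph_of_dist_le {par' : W → W} {site' : W → P}
    (hT : (treeGraph A b par site).Connected) (hT' : (treeGraph A b par' site').Connected) {M : ℕ}
    (h : ∀ w, (treeGraph A b par site).dist (w, b) (par' w, site' w) ≤ M)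
    (h' : ∀ w, (treeGraph A b par' site').dist (w, b) (par w, site w) ≤ M) :
    QuasiIsometricGraphs (treeGraph A b par site) (treeGraph A b par' site') := by
  refine ⟨hT, hT', id, id, M + 1, ?_, ?_, by simp, by simp⟩
  · refine treeGraph_adj_induction (fun x y h => ?_) (fun w p q h => ?_)
      fun w => (h' w).trans (by omega)
    · rwa [SimpleGraph.dist_comm]
    · exact (dist_le_one_of_adj_or_eq (Or.inl (treeGraph_adj_fiber w h))).trans (by omega)
  · refine treeGraph_adj_induction (fun x y h => ?_) (fun w p q h => ?_)
      fun w => (h w).trans (by omega)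
    · rwa [SimpleGraph.dist_comm]
    · exact (dist_le_one_of_adj_or_eq (Or.inl (treeGraph_adj_fiber w h))).trans (by omega)

/-- The attaching site of a copy indexed by a word: the site of its first letter. -/
def wordSite {L : Type*} (pos : L → P) (b : P) : List L → P
  | [] => b
  | l :: _ => pos l

/-- The regular tree of copies of `A`, with exactly one copy attached for each label in `L` and
each copy. -/
def wordGraph {L : Type*} (A : SimpleGraph P) (b : P) (pos : L → P) : SimpleGraph (List L × P) :=
  treeGraph A b List.tail (wordSite pos b)

theorem wordGraph_connected {L : Type*} (hA : A.Connected) (pos : L → P) :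
    (wordGraph A b pos).Connected := by
  refine treeGraph_connected hA (o := []) (depth := List.length) fun w hw => ?_
  cases w with
  | nil => exact absurd rfl hw
  | cons l u => simp

/-- Every copy has a unique address, the word of labels on the path to the root, so the two graphs
are in fact isomorphic. The conditions on `o` match the conventions `[].tail = []` and `wordSite pos
b [] = b`, which make the root's parent edge a loop that `fromRel` discards. -/
theorem quasiIsometricGraphs_wordGraph {L : Type*} (hA : A.Connected) (pos : L → P) {o : W}
    {depth : W → ℕ} (hd : ∀ w, w ≠ o → depth (par w) < depth w) (ho : par o = o) (ho' : site o = b)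
    (label : W → L) (hlabel : ∀ w, w ≠ o → site w = pos (label w))
    (hex : ∀ v l, ∃ c, c ≠ o ∧ par c = v ∧ label c = l)
    (huniq : ∀ c c', c ≠ o → c' ≠ o → par c = par c' → label c = label c' → c = c') :
    QuasiIsometricGraphs (treeGraph A b par site) (wordGraph A b pos) := by
  choose child hne hpar hlab using hex
  let f : List L → W := fun u => u.foldr (fun l v => child v l) o
  have hf0 : f [] = o := rfl
  have hf1 : ∀ l u, f (l :: u) = child (f u) l := fun _ _ => rfl
  have hpf : ∀ u, par (f u) = f u.tail := by
    intro u
    cases u with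
    | nil => exact ho
    | cons l u => exact hpar _ _
  have hsf : ∀ u, site (f u) = wordSite pos b u := by
    intro u
    cases u with
    | nil => exact ho'
    | cons l u => rw [hf1, hlabel _ (hne _ _), hlab]; rfl
  have hinj : Function.Injective f := by
    intro u
    induction u with
    | nil =>
      intro v h
      cases v with
      | nil => rfl
      | cons l v => exact absurd h.symm (hne _ _)
    | cons l u ih =>
      intro v h
      cases v with
      | nil => exact absurd h (hne _ _)
      | cons l' v =>
        have h1 := congrArg par h
        have h2 := congrArg label h
        rw [hpf, hpf] at h1
        rw [hf1, hf1, hlab, hlab] at h2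
        have h3 : u = v := ih h1
        rw [h2, h3]
  have hsurj : Function.Surjective f := by
    have key : ∀ n w, depth w = n → ∃ u, f u = w := by
      intro n
      induction n using Nat.strong_induction_on with
      | _ n ih =>
        intro w hw
        by_cases h : w = o
        · exact ⟨[], h.symm⟩
        · obtain ⟨u, hu⟩ := ih _ (hw ▸ hd w h) (par w) rfl
          exact ⟨label w :: u, huniq _ _ (hne _ _) h
            (by rw [hf1, hpar, hu]) (by rw [hf1, hlab])⟩
    exact fun w => key _ w rfl
  let e := Equiv.ofBijective f ⟨hinj, hsurj⟩
  have he : ∀ u, e u = f u := fun _ => rfl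
  have hes : ∀ w, e.symm (par w) = (e.symm w).tail := by
    intro w
    rw [Equiv.symm_apply_eq, he, ← hpf, ← he, Equiv.apply_symm_apply]
  have hes' : ∀ w, site w = wordSite pos b (e.symm w) := by
    intro w
    rw [← hsf, ← he, Equiv.apply_symm_apply]
  have hW := wordGraph_connected (b := b) hA pos
  refine ⟨treeGraph_connected hA hd, hW, fun x => (e.symm x.1, x.2), fun x => (e x.1, x.2), 1,
    ?_, ?_, by simp, by simp⟩
  · refine treeGraph_adj_induction (fun x y h => ?_) (fun w p q h => ?_) fun w => ?_
    · rwa [SimpleGraph.dist_comm]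
    · exact dist_le_one_of_adj_or_eq (Or.inl (treeGraph_adj_fiber _ h))
    · simp only [hes, hes']
      exact treeGraph_dist_parent_le _
  · refine treeGraph_adj_induction (fun x y h => ?_) (fun w p q h => ?_) fun w => ?_
    · rwa [SimpleGraph.dist_comm]
    · exact dist_le_one_of_adj_or_eq (Or.inl (treeGraph_adj_fiber _ h))
    · simp only [he, ← hpf, ← hsf]
      exact treeGraph_dist_parent_le _

end TreeGraph

/-! ### Infinite label sets: sliding surplus siblings. -/

section Sliding

theorem exists_recursion_on_parent {W X : Type*} {o : W} {par : W → W} {depth : W → ℕ}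
    (hd : ∀ w, w ≠ o → depth (par w) < depth w) (a : X) (Φ : W → X → X) :
    ∃ K : W → X, K o = a ∧ ∀ c, c ≠ o → K c = Φ c (K (par c)) := by
  classical
  let wf : WellFounded fun v w : W => depth v < depth w := InvImage.wf depth Nat.lt_wfRel.wf
  refine ⟨wf.fix fun c ih => if h : c = o then a else Φ c (ih (par c) (hd c h)), ?_, ?_⟩
  · rw [wf.fix_eq]; simp
  · intro c hc
    rw [wf.fix_eq]; simp [hc]

/-- Finiteness sits behind the existential so that `choose` gives a numbering depending on the set
alone; siblings in the same set then automatically share it. -/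
theorem exists_bijOn_Iio_ncard {W : Type*} (F : Set W) :
    ∃ e : W → ℕ, F.Finite → Set.BijOn e F (Set.Iio F.ncard) := by
  by_cases hF : F.Finite
  · rcases isEmpty_or_nonempty W with hW | hW
    · refine ⟨fun _ => 0, fun _ => ?_⟩
      have : F = ∅ := Set.eq_empty_of_isEmpty F
      subst this
      simp
    · have h : (Set.Iio F.ncard).encard = F.encard := by
        rw [← hF.cast_ncard_eq, ← (Set.finite_Iio F.ncard).cast_ncard_eq]
        simp
      obtain ⟨f, hf⟩ := (Set.finite_Iio F.ncard).exists_bijOn_of_encard_eq h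
      exact ⟨Function.invFunOn f (Set.Iio F.ncard), fun _ =>
        (Set.bijOn_comm hf.invOn_invFunOn).2 hf⟩
  · exact ⟨fun _ => 0, fun h => absurd h hF⟩

/-- Given disjoint sequences `s` and `s'` of labels, divert the labels `s 1, …, s k` to
`s' 1, …, s' k`. -/
noncomputable def divert {L : Type*} (s s' : ℕ → L) (k : ℕ) (l : L) : L :=
  open Classical in if h : ∃ i, (1 ≤ i ∧ i ≤ k) ∧ s i = l then s' h.choose else l

section Divert

variable {L : Type*} {s s' : ℕ → L}

theorem divert_eq_self_or (k : ℕ) (l : L) :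
    divert s s' k l = l ∨ ∃ i ≤ k, l = s i ∧ divert s s' k l = s' i := by
  unfold divert
  split_ifs with h
  · exact Or.inr ⟨h.choose, h.choose_spec.1.2, h.choose_spec.2.symm, rfl⟩
  · exact Or.inl rfl

theorem divert_ne (hss : ∀ i j, s i ≠ s' j) (k : ℕ) (l : L) {i : ℕ} (h1 : 1 ≤ i) (hk : i ≤ k) :
    divert s s' k l ≠ s i := by
  unfold divert
  split_ifs with h
  · exact (hss _ _).symm
  · exact fun e => h ⟨i, ⟨h1, hk⟩, e.symm⟩

theorem divert_of_not {k : ℕ} {l : L} (h : ¬ ∃ i, (1 ≤ i ∧ i ≤ k) ∧ s i = l) :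
    divert s s' k l = l := by
  unfold divert
  rw [dif_neg h]

end Divert

/-- Sliding copies along the edges of a tree in which every copy carries between one and `N`
attached copies for each label, one arrives at a tree with exactly one attached copy for each
label. -/
theorem exists_sliding {W L : Type*} [Infinite L] {o : W} {par : W → W} {depth : W → ℕ}
    (hd : ∀ w, w ≠ o → depth (par w) < depth w) (ho : par o = o) (α : W → L) {N : ℕ}
    (hfin : ∀ v l, {c | c ≠ o ∧ par c = v ∧ α c = l}.Finite)
    (hcard : ∀ v l, {c | c ≠ o ∧ par c = v ∧ α c = l}.ncard ≤ N)
    (hne : ∀ v l, {c | c ≠ o ∧ par c = v ∧ α c = l}.Nonempty) :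
    ∃ (s s' : ℕ → L) (par' : W → W) (label : W → L) (depth' : W → ℕ),
      (∀ w, w ≠ o → depth' (par' w) < depth' w) ∧ par' o = o ∧
      (∀ v l, ∃ c, c ≠ o ∧ par' c = v ∧ label c = l) ∧
      (∀ c c', c ≠ o → c' ≠ o → par' c = par' c' → label c = label c' → c = c') ∧
      ∀ c, c ≠ o → ∃ h, h ≠ o ∧ par h = par c ∧ par' h = par c ∧
        (label h = α c ∨ ∃ i ≤ 2 * N, α c = s i ∧ label h = s' i) ∧
        (label h = α h ∨ ∃ i ≤ 2 * N, α h = s i ∧ label h = s' i) ∧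
        (c = h ∨ ∃ i ≤ 2 * N, par' c = h ∧ label c = s i) := by
  classical
  obtain ⟨j⟩ : Nonempty (ℕ ↪ L) := ⟨Infinite.natEmbedding L⟩
  let s : ℕ → L := fun i => j (2 * i)
  let s' : ℕ → L := fun i => j (2 * i + 1)
  have hss : ∀ i k, s i ≠ s' k := fun i k h => by have := j.injective h; omega
  have hs : ∀ i k, s i = s k → i = k := fun i k h => by have := j.injective h; omega
  have hs' : ∀ i k, s' i = s' k → i = k := fun i k h => by have := j.injective h; omega
  let F : W → ℕ → L → Set W := fun v k l => {c | c ≠ o ∧ par c = v ∧ divert s s' k (α c) = l}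
  -- Diversion only merges the label `s i` into `s' i`, so a new label class is covered by two old
  -- ones. This is the source of the bound `2 * N`.
  have hF : ∀ v k l, ∃ m, F v k l ⊆
      {c | c ≠ o ∧ par c = v ∧ α c = l} ∪ {c | c ≠ o ∧ par c = v ∧ α c = m} := by
    intro v k l
    by_cases hl : ∃ i, l = s' i
    · obtain ⟨i, hi⟩ := hl
      refine ⟨s i, ?_⟩
      rintro c ⟨h1, h2, h3⟩
      rcases divert_eq_self_or (s := s) (s' := s') k (α c) with h | ⟨i', -, h, h'⟩
      · exact Or.inl ⟨h1, h2, h.symm.trans h3⟩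
      · have := hs' i' i (by rw [← h', h3, hi])
        subst this
        exact Or.inr ⟨h1, h2, h⟩
    · refine ⟨l, ?_⟩
      rintro c ⟨h1, h2, h3⟩
      rcases divert_eq_self_or (s := s) (s' := s') k (α c) with h | ⟨i', -, h, h'⟩
      · exact Or.inl ⟨h1, h2, h.symm.trans h3⟩
      · exact absurd ⟨i', by rw [← h', h3]⟩ hl
  have hFfin : ∀ v k l, (F v k l).Finite := by
    intro v k l
    obtain ⟨m, hm⟩ := hF v k l
    exact ((hfin v l).union (hfin v m)).subset hm
  have hFcard : ∀ v k l, (F v k l).ncard ≤ 2 * N := by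
    intro v k l
    obtain ⟨m, hm⟩ := hF v k l
    have h1 := Set.ncard_le_ncard hm ((hfin v l).union (hfin v m))
    have h2 := Set.ncard_union_le {c | c ≠ o ∧ par c = v ∧ α c = l}
      {c | c ≠ o ∧ par c = v ∧ α c = m}
    have h3 := hcard v l
    have h4 := hcard v m
    omega
  choose e he using exists_bijOn_Iio_ncard (W := W)
  have heF := fun v k l => he (F v k l) (hFfin v k l)
  -- `K c` is the number of siblings that will be moved onto `c`: all others of its block if `c` is
  -- the first one, none otherwise. They take the sites `s 1, …, s (K c)` of `c`, whose former
  -- occupants are diverted. The block of `c` depends on the diversion at its parent, whence the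
  -- recursion.
  obtain ⟨K, hKo, hK⟩ := exists_recursion_on_parent hd 0 fun c k =>
    if e (F (par c) k (divert s s' k (α c))) c = 0 then
      (F (par c) k (divert s s' k (α c))).ncard - 1 else 0
  let r : W → L := fun c => divert s s' (K (par c)) (α c)
  let B : W → Set W := fun c => F (par c) (K (par c)) (r c)
  have hBmem : ∀ c, c ≠ o → c ∈ B c := fun c hc => ⟨hc, rfl, rfl⟩
  have hBeq : ∀ c d, d ∈ B c → B d = B c := by
    rintro c d ⟨-, h1, h2⟩
    have h3 : r d = r c := by change divert s s' (K (par d)) (α d) = _; rw [h1]; exact h2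
    change F (par d) (K (par d)) (r d) = _
    rw [h1, h3]
  have hbij : ∀ c, Set.BijOn (e (B c)) (B c) (Set.Iio (B c).ncard) := fun c => heF _ _ _
  have hBcard : ∀ c, (B c).ncard ≤ 2 * N := fun c => hFcard _ _ _
  have hKB : ∀ c, c ≠ o → K c = if e (B c) c = 0 then (B c).ncard - 1 else 0 := hK
  have hhead : ∀ c, c ≠ o → ∃ h ∈ B c, e (B c) h = 0 := by
    intro c hc
    have h0 : 0 < (B c).ncard :=
      (Set.ncard_pos (hFfin _ _ _)).2 ⟨c, hBmem c hc⟩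
    obtain ⟨h, h1, h2⟩ := (hbij c).surjOn (show 0 ∈ Set.Iio (B c).ncard from h0)
    exact ⟨h, h1, h2⟩
  choose! hd' hhB hh0 using hhead
  let idx : W → ℕ := fun c => e (B c) c
  have hidx : ∀ c, c ≠ o → idx c < (B c).ncard := fun c hc => (hbij c).mapsTo (hBmem c hc)
  have hho : ∀ c, c ≠ o → hd' c ≠ o := fun c hc => (hhB c hc).1
  have hhpar : ∀ c, c ≠ o → par (hd' c) = par c := fun c hc => (hhB c hc).2.1
  have hhBB : ∀ c, c ≠ o → B (hd' c) = B c := fun c hc => hBeq c _ (hhB c hc)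
  have hhidx : ∀ c, c ≠ o → idx (hd' c) = 0 := by
    intro c hc
    change e (B (hd' c)) (hd' c) = 0
    rw [hhBB c hc]; exact hh0 c hc
  have hBr : ∀ c d, d ∈ B c → r d = r c := by
    rintro c d ⟨-, h1, h2⟩
    change divert s s' (K (par d)) (α d) = _
    rw [h1]; exact h2
  have hBinj : ∀ c d, c ≠ o → d ≠ o → B c = B d → idx c = idx d → c = d := by
    intro c d hc hd hB hi
    refine (hbij d).injOn (hB ▸ hBmem c hc) (hBmem d hd) ?_
    change e (B c) c = e (B d) d at hi
    rwa [hB] at hi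
  have hmem_of_r : ∀ c d, c ≠ o → par c = par d → r c = r d → B c = B d := by
    intro c d hc h1 h2
    change F _ _ _ = F _ _ _
    rw [h1, h2]
  -- The head of a block (index `0`) stays where it is, with its diverted label; the sibling of
  -- index `i ≥ 1` moves to the site `s i` of the head.
  let par' : W → W := fun c => if c = o then o else if idx c = 0 then par c else hd' c
  let label : W → L := fun c => if idx c = 0 then r c else s (idx c)
  have hpar0 : ∀ c, c ≠ o → idx c = 0 → par' c = par c := fun c hc h => by simp [par', hc, h]
  have hpar1 : ∀ c, c ≠ o → idx c ≠ 0 → par' c = hd' c := fun c hc h => by simp [par', hc, h]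
  have hlab0 : ∀ c, idx c = 0 → label c = r c := fun c h => by simp [label, h]
  have hlab1 : ∀ c, idx c ≠ 0 → label c = s (idx c) := fun c h => by simp [label, h]
  have hKle : ∀ c, K c ≤ 2 * N := by
    intro c
    by_cases hc : c = o
    · rw [hc, hKo]; omega
    · rw [hKB c hc]
      have := hBcard c
      split_ifs <;> omega
  have hr : ∀ c, r c = α c ∨ ∃ i ≤ 2 * N, α c = s i ∧ r c = s' i := by
    intro c
    rcases divert_eq_self_or (s := s) (s' := s') (K (par c)) (α c) with h | ⟨i, h1, h2, h3⟩
    · exact Or.inl h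
    · exact Or.inr ⟨i, h1.trans (hKle _), h2, h3⟩
  have hstolen : ∀ c, c ≠ o → idx c ≠ 0 → idx c ≤ K (hd' c) := by
    intro c hc h
    rw [hKB _ (hho c hc), hhBB c hc, if_pos (hh0 c hc)]
    have := hidx c hc
    omega
  -- Doubling the old depth leaves room for one more level: moved siblings lie just below the head
  -- of their block.
  refine ⟨s, s', par', label, 
    fun c => if c = o then 0 else 2 * depth (par c) + if idx c = 0 then 1 else 2, ?_, ?_, ?_, ?_, ?_⟩
  · intro c hc
    by_cases h : idx c = 0
    · dsimp only
      rw [hpar0 c hc h, if_neg hc, if_pos h]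
      split_ifs with h1 h2
      · omega
      · have := hd _ h1
        omega
      · have := hd _ h1
        omega
    · dsimp only
      rw [hpar1 c hc h, if_neg hc, if_neg h, if_neg (hho c hc), if_pos (hhidx c hc), hhpar c hc]
      omega
  · simp [par']
  · intro v l
    -- A vacated label is filled by a sibling moved onto `v`; any other label still has its original
    -- children, whose block has a head.
    by_cases hl : ∃ i, (1 ≤ i ∧ i ≤ K v) ∧ s i = l
    · obtain ⟨i, ⟨h1, h2⟩, h3⟩ := hl
      have hv : v ≠ o := by rintro rfl; omega
      have hv0 : e (B v) v = 0 := by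
        by_contra h
        rw [hKB v hv, if_neg h] at h2
        omega
      rw [hKB v hv, if_pos hv0] at h2
      obtain ⟨c, hc, hci⟩ := (hbij v).surjOn (show i ∈ Set.Iio (B v).ncard by
        change i < _; omega)
      have hco : c ≠ o := hc.1
      have hBc := hBeq v c hc
      have hic : idx c = i := by change e (B c) c = i; rw [hBc, hci]
      refine ⟨c, hco, ?_, ?_⟩
      · rw [hpar1 c hco (by omega)]
        refine hBinj _ _ (hho c hco) hv (by rw [hhBB c hco, hBc]) ?_
        rw [hhidx c hco]; exact hv0.symm
      · rw [hlab1 c (by omega), hic, h3]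
    · obtain ⟨d, hd1, hd2, hd3⟩ := hne v l
      have hrd : r d = l := by
        change divert s s' (K (par d)) (α d) = l
        rw [hd2, hd3, divert_of_not hl]
      refine ⟨hd' d, hho d hd1, ?_, ?_⟩
      · rw [hpar0 _ (hho d hd1) (hhidx d hd1), hhpar d hd1, hd2]
      · rw [hlab0 _ (hhidx d hd1), hBr d _ (hhB d hd1), hrd]
  -- A head carries a diverted label, which avoids the vacated labels used by the siblings moved
  -- onto its parent.
  · have cross : ∀ c c', c ≠ o → c' ≠ o → idx c = 0 → idx c' ≠ 0 → par' c = par' c' →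
        label c ≠ label c' := by
      intro c c' hc hc' h h' hp
      rw [hlab0 c h, hlab1 c' h']
      rw [hpar0 c hc h, hpar1 c' hc' h'] at hp
      refine divert_ne hss _ _ (by omega) ?_
      rw [hp]
      exact hstolen c' hc' h'
    intro c c' hc hc' hp hl
    by_cases h : idx c = 0 <;> by_cases h' : idx c' = 0
    · rw [hpar0 c hc h, hpar0 c' hc' h'] at hp
      rw [hlab0 c h, hlab0 c' h'] at hl
      exact hBinj c c' hc hc' (hmem_of_r c c' hc hp hl) (h.trans h'.symm)
    · exact absurd hl (cross c c' hc hc' h h' hp)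
    · exact absurd hl.symm (cross c' c hc' hc h' h hp.symm)
    · rw [hpar1 c hc h, hpar1 c' hc' h'] at hp
      rw [hlab1 c h, hlab1 c' h'] at hl
      refine hBinj c c' hc hc' ?_ (hs _ _ hl)
      rw [← hhBB c hc, hp, hhBB c' hc']
  · intro c hc
    have h0 := hhidx c hc
    refine ⟨hd' c, hho c hc, hhpar c hc, ?_, ?_, ?_, ?_⟩
    · rw [hpar0 _ (hho c hc) h0, hhpar c hc]
    · rw [hlab0 _ h0, hBr c _ (hhB c hc)]
      exact hr c
    · rw [hlab0 _ h0]
      exact hr _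
    · by_cases h : idx c = 0
      · left
        exact hBinj c _ hc (hho c hc) (hhBB c hc).symm (h.trans h0.symm)
      · right
        refine ⟨idx c, ?_, hpar1 c hc h, hlab1 c h⟩
        have := hidx c hc
        have := hBcard c
        omega

/-- Sliding moves each attaching edge a bounded distance: the diversions only involve `s i` and `s'
i` with `i ≤ 2 * N`, a finite list that is the same for all copies. -/
theorem quasiIsometricGraphs_wordGraph_of_infinite {W P L : Type*} [Infinite L]
    {A : SimpleGraph P} {b : P} {par : W → W} {site : W → P} (hA : A.Connected) (pos : L → P) {o : W}
    {depth : W → ℕ} (hd : ∀ w, w ≠ o → depth (par w) < depth w) (ho : par o = o) (ho' : site o = b)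
    (α : W → L) {R N : ℕ} (hR : ∀ c, c ≠ o → A.dist (site c) (pos (α c)) ≤ R)
    (hfin : ∀ v l, {c | c ≠ o ∧ par c = v ∧ α c = l}.Finite)
    (hcard : ∀ v l, {c | c ≠ o ∧ par c = v ∧ α c = l}.ncard ≤ N)
    (hne : ∀ v l, {c | c ≠ o ∧ par c = v ∧ α c = l}.Nonempty) :
    QuasiIsometricGraphs (treeGraph A b par site) (wordGraph A b pos) := by
  classical
  obtain ⟨s, s', par', label, depth', hd', hpo, hex, huniq, hnear⟩ :=
    exists_sliding hd ho α hfin hcard hne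
  let site' : W → P := fun c => if c = o then b else pos (label c)
  have hsite' : ∀ c, c ≠ o → site' c = pos (label c) := fun c hc => if_neg hc
  have hsiteo : site' o = b := if_pos rfl
  refine QuasiIsometricGraphs.trans ?_ (quasiIsometricGraphs_wordGraph hA pos hd' hpo hsiteo label
    hsite' hex huniq)
  have hT : (treeGraph A b par site).Connected := treeGraph_connected hA hd
  have hT' : (treeGraph A b par' site').Connected := treeGraph_connected hA hd'
  obtain ⟨D, hD⟩ : ∃ D, ∀ i ≤ 2 * N, A.dist (pos (s i)) (pos (s' i)) ≤ D :=
    ⟨(Finset.range (2 * N + 1)).sup fun i => A.dist (pos (s i)) (pos (s' i)), fun i hi =>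
      Finset.le_sup (f := fun i => A.dist (pos (s i)) (pos (s' i))) (Finset.mem_range.2 (by omega))⟩
  obtain ⟨E, hE⟩ : ∃ E, ∀ i ≤ 2 * N, A.dist b (pos (s i)) ≤ E :=
    ⟨(Finset.range (2 * N + 1)).sup fun i => A.dist b (pos (s i)), fun i hi =>
      Finset.le_sup (f := fun i => A.dist b (pos (s i))) (Finset.mem_range.2 (by omega))⟩
  have near : ∀ c, c ≠ o → ∀ l, (l = α c ∨ ∃ i ≤ 2 * N, α c = s i ∧ l = s' i) →
      A.dist (site c) (pos l) ≤ R + D := by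
    rintro c hc l (rfl | ⟨i, hi, h1, h2⟩)
    · exact (hR c hc).trans (by omega)
    · have a := hR c hc
      have e := hD i hi
      have f := hA.dist_triangle (u := site c) (v := pos (α c)) (w := pos l)
      rw [← h1, ← h2] at e
      omega
  -- From `c` to its head `h` through the parent copy costs `2 * (1 + R + D)`; moving inside `h`
  -- from the base point to the site `s i` costs `E`.
  refine quasiIsometricGraphs_treeGraph_of_dist_le (M := 2 * (1 + R + D) + E) hT hT' ?_ ?_
  · intro c
    by_cases hc : c = o
    · rw [hc, hpo, hsiteo]; simp
    · obtain ⟨h, h0, h1, h2, h3, h4, h5⟩ := hnear c hc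
      have k1 := near c hc _ h3
      have k2 := near h h0 _ h4
      have k3 := treeGraph_dist_base_le hA hT c (pos (label h))
      have k4 := treeGraph_dist_base_le hA hT h (pos (label h))
      rw [hsite' c hc]
      rcases h5 with rfl | ⟨i, hi, h5, h6⟩
      · rw [h2]
        omega
      · rw [h5, h6]
        have k5 := treeGraph_dist_fiber_le hA hT h b (pos (s i))
        have k6 := hE i hi
        have k7 := hT.dist_triangle (u := (c, b)) (v := (par c, pos (label h))) (w := (h, b))
        have k8 := hT.dist_triangle (u := (c, b)) (v := (h, b)) (w := (h, pos (s i)))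
        rw [h1, SimpleGraph.dist_comm] at k4
        omega
  · intro c
    by_cases hc : c = o
    · rw [hc, ho, ho']; simp
    · obtain ⟨h, h0, h1, h2, h3, h4, h5⟩ := hnear c hc
      have k1 := near c hc _ h3
      rw [SimpleGraph.dist_comm, ← hsite' h h0] at k1
      have k4 := treeGraph_dist_base_le hA hT' h (site c)
      rw [h2] at k4
      rcases h5 with rfl | ⟨i, hi, h5, h6⟩
      · omega
      · have k3 := treeGraph_dist_base_le hA hT' c b
        rw [h5, hsite' c hc, h6, SimpleGraph.dist_comm (G := A)] at k3
        have k6 := hE i hi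
        have k7 := hT'.dist_triangle (u := (c, b)) (v := (h, b)) (w := (par c, site c))
        omega

end Sliding

/-! ### Finite copies: refinement to the binary tree. -/

section Caterpillar

/-- A tree in which every vertex has between two and `N` children becomes a binary tree after every
vertex is replaced by a path. -/
theorem exists_binary_refinement {W : Type*} {o : W} {par : W → W} {depth : W → ℕ}
    (hd : ∀ w, w ≠ o → depth (par w) < depth w) {N : ℕ}
    (hfin : ∀ v, {c | c ≠ o ∧ par c = v}.Finite)
    (hlow : ∀ v, 2 ≤ {c | c ≠ o ∧ par c = v}.ncard)
    (hupp : ∀ v, {c | c ≠ o ∧ par c = v}.ncard ≤ N) :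
    ∃ (V : Set (W × ℕ)) (par' : V → V) (o' : V) (label : V → Bool) (depth' : V → ℕ),
      (∀ w, (w, 0) ∈ V) ∧ (∀ w i, (w, i) ∈ V → i ≤ N) ∧ (o' : W × ℕ) = (o, 0) ∧ par' o' = o' ∧
      (∀ w, w ≠ o' → depth' (par' w) < depth' w) ∧
      (∀ v l, ∃ c, c ≠ o' ∧ par' c = v ∧ label c = l) ∧
      (∀ c c', c ≠ o' → c' ≠ o' → par' c = par' c' → label c = label c' → c = c') ∧
      (∀ w i (h : (w, i + 1) ∈ V), ((par' ⟨(w, i + 1), h⟩ : V) : W × ℕ) = (w, i)) ∧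
      ∀ w (h : (w, 0) ∈ V), w ≠ o → ∃ j, ((par' ⟨(w, 0), h⟩ : V) : W × ℕ) = (par w, j) := by
  classical
  choose e he using exists_bijOn_Iio_ncard (W := W)
  let n : W → ℕ := fun v => {c | c ≠ o ∧ par c = v}.ncard
  let idx : W → ℕ := fun c => e {d | d ≠ o ∧ par d = par c} c
  have hbij := fun v => he _ (hfin v)
  have hidx : ∀ c, c ≠ o → idx c < n (par c) := fun c hc => (hbij (par c)).mapsTo ⟨hc, rfl⟩
  have hinj : ∀ c d, c ≠ o → d ≠ o → par c = par d → idx c = idx d → c = d := by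
    intro c d hc hd hp hi
    refine (hbij (par d)).injOn ⟨hc, hp⟩ ⟨hd, rfl⟩ ?_
    change e {x | x ≠ o ∧ par x = par c} c = _ at hi
    rwa [hp] at hi
  have hsurj : ∀ v i, i < n v → ∃ c, c ≠ o ∧ par c = v ∧ idx c = i := by
    intro v i hi
    obtain ⟨c, hc, hci⟩ := (hbij v).surjOn (show i ∈ Set.Iio _ from hi)
    refine ⟨c, hc.1, hc.2, ?_⟩
    change e {x | x ≠ o ∧ par x = par c} c = _
    rw [hc.2]; exact hci
  -- A vertex with `n` children becomes a path with `n - 1` vertices. Child `i` hangs from path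
  -- vertex `i`, except that the last path vertex carries the two children `n - 2` and `n - 1`;
  -- hence the `min` below.
  let V : Set (W × ℕ) := {x | x.2 + 2 ≤ n x.1}
  have hn2 : ∀ v, 2 ≤ n v := hlow
  have hV0 : ∀ w, (w, 0) ∈ V := fun w => by change 0 + 2 ≤ n w; exact hn2 w
  have hVmin : ∀ w, (par w, min (idx w) (n (par w) - 2)) ∈ V := by
    intro w
    have := hn2 (par w)
    change min _ _ + 2 ≤ n (par w)
    omega
  have hVpred : ∀ w i, (w, i + 1) ∈ V → (w, i) ∈ V := by
    intro w i h
    change i + 1 + 2 ≤ n w at h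
    change i + 2 ≤ n w
    omega
  let raw : W × ℕ → W × ℕ := fun x => if x.2 = 0 then
    if x.1 = o then x else (par x.1, min (idx x.1) (n (par x.1) - 2)) else (x.1, x.2 - 1)
  have hraw : ∀ x ∈ V, raw x ∈ V := by
    rintro ⟨w, i⟩ h
    simp only [raw]
    split_ifs with h1 h2
    · exact h
    · exact hVmin w
    · change i + 2 ≤ n w at h
      change i - 1 + 2 ≤ n w
      omega
  let par' : V → V := fun x => ⟨raw x, hraw x x.2⟩
  -- `true` marks the continuation of the path, whose role at the end of the path is played by the
  -- last child.
  let label : V → Bool := fun x =>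
    if x.1.2 = 0 then decide (idx x.1.1 + 1 = n (par x.1.1)) else true
  have hp0 : ∀ w h, w ≠ o → par' ⟨(w, 0), h⟩ = ⟨_, hVmin w⟩ := fun w h hw =>
    Subtype.ext (by simp [par', raw, hw])
  have hps : ∀ w i h, par' ⟨(w, i + 1), h⟩ = ⟨(w, i), hVpred w i h⟩ := fun _ _ _ => rfl
  have hl0 : ∀ w h, label ⟨(w, 0), h⟩ = decide (idx w + 1 = n (par w)) := fun _ _ => rfl
  have hls : ∀ w i h, label ⟨(w, i + 1), h⟩ = true := fun _ _ _ => rfl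
  have hne0 : ∀ w h, (⟨(w, 0), h⟩ : V) ≠ ⟨(o, 0), hV0 o⟩ ↔ w ≠ o := by
    intro w h
    simp
  -- Positions on a path are smaller than `N`, so one level of the old tree outweighs them.
  refine ⟨V, par', ⟨(o, 0), hV0 o⟩, label, fun x => N * depth x.1.1 + x.1.2, hV0, ?_, rfl,
    Subtype.ext (by simp [par', raw]), ?_, ?_, ?_, fun w i h => rfl, fun w h hw => ⟨_, by rw [hp0 w h hw]⟩⟩
  · intro w i h
    change i + 2 ≤ n w at h
    have : n w ≤ N := hupp w
    omega
  · rintro ⟨⟨w, _ | i⟩, h⟩ hw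
    · rw [hne0] at hw
      rw [hp0 w h hw]
      have h1 : n (par w) ≤ N := hupp (par w)
      have h2 := hn2 (par w)
      have h3 := Nat.mul_le_mul_left N (Nat.succ_le_of_lt (hd w hw))
      rw [Nat.mul_succ] at h3
      simp only
      omega
    · rw [hps]
      simp
  · rintro ⟨⟨w, i⟩, h⟩ l
    have h' : i + 2 ≤ n w := h
    cases l with
    | false =>
      obtain ⟨c, hc, rfl, hi⟩ := hsurj w i (by omega)
      refine ⟨⟨(c, 0), hV0 c⟩, (hne0 c _).2 hc, ?_, ?_⟩
      · rw [hp0 c _ hc]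
        simp only [Subtype.mk.injEq, Prod.mk.injEq, true_and]
        omega
      · rw [hl0]
        simp only [decide_eq_false_iff_not]
        omega
    | true =>
      by_cases hi : i + 3 ≤ n w
      · refine ⟨⟨(w, i + 1), by change i + 1 + 2 ≤ n w; omega⟩, by simp, rfl, rfl⟩
      · obtain ⟨c, hc, rfl, hi⟩ := hsurj w (i + 1) (by omega)
        refine ⟨⟨(c, 0), hV0 c⟩, (hne0 c _).2 hc, ?_, ?_⟩
        · rw [hp0 c _ hc]
          simp only [Subtype.mk.injEq, Prod.mk.injEq, true_and]
          omega
        · rw [hl0]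
          simp only [decide_eq_true_eq]
          omega
  · have cross : ∀ c h, c ≠ o → ∀ w i h', par' ⟨(c, 0), h⟩ = par' ⟨(w, i + 1), h'⟩ →
        label ⟨(c, 0), h⟩ ≠ label ⟨(w, i + 1), h'⟩ := by
      intro c h hc w i h' hp hl
      rw [hp0 c h hc, hps] at hp
      simp only [Subtype.mk.injEq, Prod.mk.injEq] at hp
      rw [hl0, hls] at hl
      simp only [decide_eq_true_eq] at hl
      have h'' : i + 1 + 2 ≤ n w := h'
      obtain ⟨rfl, hp⟩ := hp
      omega
    rintro ⟨⟨w, _ | i⟩, h⟩ ⟨⟨w', _ | i'⟩, h'⟩ hw hw' hp hl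
    · rw [hne0] at hw hw'
      rw [hp0 w h hw, hp0 w' h' hw'] at hp
      rw [hl0, hl0] at hl
      simp only [Subtype.mk.injEq, Prod.mk.injEq] at hp
      simp only [decide_eq_decide] at hl
      have h1 := hidx w hw
      have h2 := hidx w' hw'
      obtain ⟨hpar, hp⟩ := hp
      have : w = w' := by
        refine hinj w w' hw hw' hpar ?_
        rw [hpar] at hl hp h1
        omega
      subst this
      rfl
    · exact absurd hl (cross _ _ ((hne0 _ _).1 hw) _ _ _ hp)
    · exact absurd hl.symm (cross _ _ ((hne0 _ _).1 hw') _ _ _ hp.symm)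
    · rw [hps, hps] at hp
      simp only [Subtype.mk.injEq, Prod.mk.injEq] at hp
      simp [hp.1, hp.2]

/-- Copies of a finite connected graph have bounded diameter, so each collapses to a point and the
sites become irrelevant. -/
theorem quasiIsometricGraphs_wordGraph_of_finite {W P : Type*} [Finite P]
    {A : SimpleGraph P} {b : P} {par : W → W} {site : W → P} (hA : A.Connected) {o : W}
    {depth : W → ℕ} (hd : ∀ w, w ≠ o → depth (par w) < depth w) (ho : par o = o) {N : ℕ}
    (hfin : ∀ v, {c | c ≠ o ∧ par c = v}.Finite)
    (hlow : ∀ v, 2 ≤ {c | c ≠ o ∧ par c = v}.ncard)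
    (hupp : ∀ v, {c | c ≠ o ∧ par c = v}.ncard ≤ N) :
    QuasiIsometricGraphs (treeGraph A b par site)
      (wordGraph (⊥ : SimpleGraph Unit) () fun _ : Bool => ()) := by
  classical
  obtain ⟨V, par', o', label, depth', hV0, hVN, ho', hpo, hd', hex, huniq, hps, hp0⟩ :=
    exists_binary_refinement hd hfin hlow hupp
  have hU : (⊥ : SimpleGraph Unit).Connected := ⟨fun _ _ => .refl _⟩
  refine QuasiIsometricGraphs.trans ?_ (quasiIsometricGraphs_wordGraph (site := fun _ : V => ()) hU
    _ hd' hpo rfl label (fun _ _ => rfl) hex huniq)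
  have hT : (treeGraph A b par site).Connected := treeGraph_connected hA hd
  have hT' : (treeGraph (⊥ : SimpleGraph Unit) () par' fun _ => ()).Connected :=
    treeGraph_connected hU hd'
  obtain ⟨D, hD⟩ : ∃ D, ∀ p q, A.dist p q ≤ D := by
    have : Fintype P := Fintype.ofFinite P
    exact ⟨Finset.univ.sup fun x : P × P => A.dist x.1 x.2, fun p q =>
      Finset.le_sup (f := fun x : P × P => A.dist x.1 x.2) (Finset.mem_univ (p, q))⟩
  let f : W × P → V × Unit := fun x => (⟨(x.1, 0), hV0 x.1⟩, ())
  let g : V × Unit → W × P := fun x => (x.1.1.1, b)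
  have chain : ∀ w i (h : (w, i) ∈ V), (treeGraph (⊥ : SimpleGraph Unit) () par' fun _ => ()).dist
      (⟨(w, i), h⟩, ()) (⟨(w, 0), hV0 w⟩, ()) ≤ i := by
    intro w i
    induction i with
    | zero => intro h; simp
    | succ i ih =>
      intro h
      have h1 : par' ⟨(w, i + 1), h⟩ = ⟨(w, i), hps w i h ▸ (par' ⟨(w, i + 1), h⟩).2⟩ :=
        Subtype.ext (hps w i h)
      have h2 := treeGraph_dist_parent_le (A := (⊥ : SimpleGraph Unit)) (b := ()) (par := par')
        (site := fun _ => ()) ⟨(w, i + 1), h⟩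
      rw [h1] at h2
      exact hT'.dist_triangle.trans ((Nat.add_le_add h2 (ih _)).trans (by omega))
  refine ⟨hT, hT', f, g, N + D + 1, ?_, ?_, ?_, ?_⟩
  · refine treeGraph_adj_induction (fun x y h => ?_) (fun w p q h => ?_) fun w => ?_
    · rwa [SimpleGraph.dist_comm]
    · simp [f]
    · by_cases hw : w = o
      · subst hw
        simp [f, ho]
      · obtain ⟨j, hj⟩ := hp0 w (hV0 w) hw
        have hj' : (par w, j) ∈ V := hj ▸ (par' ⟨(w, 0), hV0 w⟩).2
        have h1 : par' ⟨(w, 0), hV0 w⟩ = ⟨(par w, j), hj'⟩ := Subtype.ext hj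
        have h2 := treeGraph_dist_parent_le (A := (⊥ : SimpleGraph Unit)) (b := ()) (par := par')
          (site := fun _ => ()) ⟨(w, 0), hV0 w⟩
        rw [h1] at h2
        have h3 := hVN _ _ hj'
        exact hT'.dist_triangle.trans ((Nat.add_le_add h2 (chain _ _ hj')).trans (by omega))
  · refine treeGraph_adj_induction (fun x y h => ?_) (fun w p q h => ?_) fun w => ?_
    · rwa [SimpleGraph.dist_comm]
    · simp [g]
    · obtain ⟨⟨w, _ | i⟩, h⟩ := w
      · by_cases hw : w = o
        · have : (⟨(w, 0), h⟩ : V) = o' := Subtype.ext (by simp [ho', hw])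
          rw [this, hpo]
          simp
        · obtain ⟨j, hj⟩ := hp0 w h hw
          have h1 := treeGraph_dist_base_le hA hT w b
          have h2 := hD (site w) b
          simp only [g, hj]
          omega
      · simp [g, hps]
  · intro x
    have h1 := treeGraph_dist_fiber_le hA hT x.1 b x.2
    have h2 := hD b x.2
    change (treeGraph A b par site).dist (x.1, b) (x.1, x.2) ≤ _
    omega
  · rintro ⟨⟨⟨w, i⟩, h⟩, ⟨⟩⟩
    rw [SimpleGraph.dist_comm]
    have := hVN w i h
    exact (chain w i h).trans (by omega)

end Caterpillar

/-! ### The free product as a tree of copies of `G`. -/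

section FreeProductTree

variable {G H : Type*} [Group G] [Group H]

/-- The copies of `G` in the free product of `G` and `H`, given by the reduced words
`h x₁ k₁ … xₙ kₙ` with last syllable in `H`; the list starts with the last syllables. -/
abbrev CopyIndex (G H : Type*) [Group G] [Group H] : Type _ :=
  H × List ({x : G // x ≠ 1} × {h : H // h ≠ 1})

open Classical in
/-- The parent of a copy, given a function `q` that moves the elements of `H` towards `1`. -/
noncomputable def copyPar (q : H → H) : CopyIndex G H → CopyIndex G H
  | (h, []) => (q h, [])
  | (h, (x, k) :: l) => if hk : q k = 1 then (h, l) else (h, (x, ⟨q k, hk⟩) :: l)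

open Classical in
/-- The vertex of the parent copy to which a copy is attached. -/
noncomputable def copySite (q : H → H) : CopyIndex G H → G
  | (_, []) => 1
  | (_, (x, k) :: _) => if q k = 1 then x else 1

open Classical in
/-- The cosets of `H` in the free product of `G` and `H`: they are indexed by the reduced words
with last syllable in `G`. -/
noncomputable def line : Option (CopyIndex G H × {x : G // x ≠ 1}) → H → CopyIndex G H × G
  | none, k => ((k, []), 1)
  | some (w, x), k => if hk : k = 1 then (w, x) else ((w.1, (x, ⟨k, hk⟩) :: w.2), 1)

open Classical in
/-- The coset of `H` through a vertex, and the position of the vertex on it. -/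
noncomputable def toLine : CopyIndex G H × G → Option (CopyIndex G H × {x : G // x ≠ 1}) × H
  | ((h, []), y) => if hy : y = 1 then (none, h) else (some ((h, []), ⟨y, hy⟩), 1)
  | ((h, (x, k) :: l), y) =>
    if hy : y = 1 then (some ((h, l), x), k) else (some ((h, (x, k) :: l), ⟨y, hy⟩), 1)

theorem line_none (k : H) : line (G := G) none k = ((k, []), 1) := rfl

theorem line_some_one (w : CopyIndex G H) (x : {x : G // x ≠ 1}) :
    line (some (w, x)) 1 = (w, (x : G)) := by simp [line]

theorem line_some_coe (w : CopyIndex G H) (x : {x : G // x ≠ 1}) (k : {h : H // h ≠ 1}) :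
    line (some (w, x)) (k : H) = ((w.1, (x, k) :: w.2), 1) := by simp [line, k.2]

theorem line_toLine (v : CopyIndex G H × G) : line (toLine v).1 (toLine v).2 = v := by
  obtain ⟨⟨h, _ | ⟨⟨x, k⟩, l⟩⟩, y⟩ := v
  · by_cases hy : y = 1 <;> simp [toLine, hy, line]
  · by_cases hy : y = 1 <;> simp [toLine, hy, line, k.2]

theorem toLine_line (u : Option (CopyIndex G H × {x : G // x ≠ 1})) (k : H) :
    toLine (line u k) = (u, k) := by
  rcases u with _ | ⟨⟨h, _ | ⟨⟨x', k'⟩, l⟩⟩, x⟩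
  · simp [line, toLine]
  · by_cases hk : k = 1 <;> simp [line, toLine, hk, x.2]
  · by_cases hk : k = 1 <;> simp [line, toLine, hk, x.2]

theorem line_cases {motive : CopyIndex G H × G → Prop} (h : ∀ u k, motive (line u k))
    (v : CopyIndex G H × G) : motive v := line_toLine v ▸ h _ _

theorem exists_line_base (q : H → H) (c : CopyIndex G H) :
    ∃ u k, line u k = (c, 1) ∧ line u (q k) = (copyPar q c, copySite q c) := by
  obtain ⟨h, _ | ⟨⟨x, k⟩, l⟩⟩ := c
  · exact ⟨none, h, rfl, rfl⟩
  · refine ⟨some ((h, l), x), k, line_some_coe _ _ _, ?_⟩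
    by_cases hk : q k = 1 <;> simp [line, copyPar, copySite, hk]

/-- Only the position `1` on a coset other than `H` itself is not the base point of a copy: there
the coset meets its parent copy, at `x ≠ 1`. -/
theorem line_retract (q : H → H) (u : Option (CopyIndex G H × {x : G // x ≠ 1})) (k : H) :
    (k = 1 ∧ u ≠ none) ∨
      ∃ c, line u k = (c, 1) ∧ line u (q k) = (copyPar q c, copySite q c) := by
  rcases u with _ | ⟨⟨h, l⟩, x⟩
  · exact Or.inr ⟨(k, []), rfl, rfl⟩
  · by_cases hk : k = 1
    · exact Or.inl ⟨hk, by simp⟩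
    · refine Or.inr ⟨(h, (x, ⟨k, hk⟩) :: l), by simp [line, hk], ?_⟩
      by_cases hk : q k = 1 <;> simp [line, copyPar, copySite, hk]

/-- The tree on `H` in which `h` is joined with `q h`. -/
def retractionTree (q : H → H) : SimpleGraph (H × Unit) :=
  treeGraph (⊥ : SimpleGraph Unit) () q fun _ => ()

/-- `q` is the parent map of a rooted tree on the group `H` that is coarsely the Cayley graph of `H`
with respect to the finite generating set `T`. -/
structure IsCayleyTree (q : H → H) (T : Set H) : Prop where
  map_one : q 1 = 1
  exists_depth : ∃ d : H → ℕ, ∀ h, h ≠ 1 → d (q h) < d h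
  exists_step : ∀ h, h ≠ 1 → ∃ t ∈ T, q h * t = h
  finite : T.Finite
  closure_eq_top : Subgroup.closure T = ⊤
  -- This provides every copy with a child at every site `x ≠ 1`.
  exists_child : ∃ h, h ≠ 1 ∧ q h = 1
  exists_bound : ∃ K, ∀ k, ∀ t ∈ T, (retractionTree q).dist (k, ()) (k * t, ()) ≤ K

/-- The free product of `G` and `H` as a tree of copies of the Cayley graph of `G`. -/
noncomputable def freeProductTree (S : Set G) (q : H → H) : SimpleGraph (CopyIndex G H × G) :=
  treeGraph (SimpleGraph.mulCayley S) 1 (copyPar q) (copySite q)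

theorem exists_copy_depth {q : H → H} {d : H → ℕ} (hd : ∀ h, h ≠ 1 → d (q h) < d h) :
    ∃ depth : CopyIndex G H → ℕ, ∀ c, c ≠ (1, []) → depth (copyPar q c) < depth c := by
  refine ⟨fun c => d c.1 + (c.2.map fun y => d y.2 + 1).sum, ?_⟩
  rintro ⟨h, _ | ⟨⟨x, k⟩, l⟩⟩ hc
  · have := hd h (fun e => hc (by rw [e]))
    simpa [copyPar] using this
  · have := hd k k.2
    by_cases hk : q k = 1
    · simp [copyPar, hk]
    · simp [copyPar, hk]; omega

variable {S : Set G} {q : H → H} {T : Set H}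

theorem retractionTree_connected (hq : IsCayleyTree q T) : (retractionTree q).Connected := by
  obtain ⟨d, hd⟩ := hq.exists_depth
  exact treeGraph_connected ⟨fun _ _ => .refl _⟩ hd

theorem freeProductTree_connected (hS : Subgroup.closure S = ⊤) (hq : IsCayleyTree q T) :
    (freeProductTree S q).Connected := by
  obtain ⟨d, hd⟩ := hq.exists_depth
  obtain ⟨depth, hdepth⟩ := exists_copy_depth (G := G) hd
  exact treeGraph_connected (mulCayley_connected_of_closure_eq_top S hS) hdepth

/-- Each edge of `retractionTree q` becomes a parent edge on the coset, so bounds in that tree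
transfer uniformly to all cosets of `H`. -/
theorem dist_line_le (hS : Subgroup.closure S = ⊤) (hq : IsCayleyTree q T)
    (u : Option (CopyIndex G H × {x : G // x ≠ 1})) (k k' : H) :
    (freeProductTree S q).dist (line u k) (line u k') ≤
      (retractionTree q).dist (k, ()) (k', ()) := by
  refine dist_map_le (retractionTree_connected hq) (freeProductTree_connected hS hq)
    (f := fun k => line u k.1) ?_ (k, ()) (k', ())
  refine treeGraph_adj_induction (fun x y h => ?_) (fun w p q h => absurd h (by simp)) fun k => ?_
  · rcases h with h | h
    · exact Or.inl h.symm
    · exact Or.inr h.symm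
  · rcases line_retract q u k with ⟨rfl, -⟩ | ⟨c, h1, h2⟩
    · right; rw [hq.map_one]
    · simp only [h1, h2]
      exact treeGraph_adj_or_eq_parent c

/-- The copies attached to the copy `v`, up to a choice of a generator in `T`. -/
noncomputable def childCopy (v : CopyIndex G H) : Option {x : G // x ≠ 1} × H → CopyIndex G H
  | (some x, t) => (line (some (v, x)) t).1
  | (none, t) => (line (toLine (v, 1)).1 ((toLine (v, 1)).2 * t)).1

open Classical in
/-- The vertex of the parent copy to which a copy is attached, if it is not the base point. -/
noncomputable def copySite? (q : H → H) (c : CopyIndex G H) : Option {x : G // x ≠ 1} :=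
  if h : copySite q c = 1 then none else some ⟨copySite q c, h⟩

/-- As `k = q k * t` for some `t ∈ T`, a child is recovered from its parent, its site and `t`. Hence
at most `T.ncard` children share a site. -/
theorem exists_eq_childCopy (hq : IsCayleyTree q T) (c : CopyIndex G H) (hc : c ≠ (1, [])) :
    ∃ t ∈ T, childCopy (copyPar q c) (copySite? q c, t) = c := by
  obtain ⟨h, _ | ⟨⟨x, k⟩, l⟩⟩ := c
  · obtain ⟨t, ht, h1⟩ := hq.exists_step h fun e => hc (by rw [e])
    exact ⟨t, ht, by simp [copyPar, copySite?, copySite, childCopy, toLine, line, h1]⟩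
  · obtain ⟨t, ht, h1⟩ := hq.exists_step k k.2
    refine ⟨t, ht, ?_⟩
    by_cases hk : q k = 1
    · rw [hk, one_mul] at h1
      simp [copyPar, copySite?, copySite, childCopy, line, h1, hk, x.2, k.2]
    · simp [copyPar, copySite?, copySite, childCopy, toLine, line, h1, hk, k.2]

theorem copyPar_cons {k : {h : H // h ≠ 1}} (hk : q k = 1) (v : CopyIndex G H)
    (x : {x : G // x ≠ 1}) : copyPar q (v.1, (x, k) :: v.2) = v := by
  simp [copyPar, hk]

theorem copySite?_cons {k : {h : H // h ≠ 1}} (hk : q k = 1) (v : CopyIndex G H)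
    (x : {x : G // x ≠ 1}) : copySite? q (v.1, (x, k) :: v.2) = some x := by
  simp [copySite?, copySite, hk, x.2]

/-- Children attached at the base point `1` have no label of their own; they are given the label
`x₀`, at the cost `R = dist 1 x₀`. A label class then draws on at most two sites, so it has at most
`2 * T.ncard` members. -/
theorem freeProductTree_quasiIsometricGraphs_of_infinite [Infinite G]
    (hS : Subgroup.closure S = ⊤) (hq : IsCayleyTree q T) :
    QuasiIsometricGraphs (freeProductTree S q)
      (wordGraph (SimpleGraph.mulCayley S) 1 (Subtype.val : {x : G // x ≠ 1} → G)) := by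
  classical
  have hA := mulCayley_connected_of_closure_eq_top S hS
  obtain ⟨d, hd⟩ := hq.exists_depth
  obtain ⟨depth, hdepth⟩ := exists_copy_depth (G := G) hd
  obtain ⟨x₀, hx₀⟩ := exists_ne (1 : G)
  obtain ⟨k, hk1, hk⟩ := hq.exists_child
  have : Infinite {x : G // x ≠ 1} := Set.infinite_coe_iff.2
    (Set.Finite.infinite_compl (Set.finite_singleton (1 : G)))
  let α : CopyIndex G H → {x : G // x ≠ 1} := fun c => (copySite? q c).getD ⟨x₀, hx₀⟩
  have hsub : ∀ v l, {c | c ≠ (1, []) ∧ copyPar q c = v ∧ α c = l} ⊆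
      childCopy v '' (({some l, none} : Set (Option {x : G // x ≠ 1})) ×ˢ T) := by
    rintro v l c ⟨h1, rfl, rfl⟩
    obtain ⟨t, ht, h2⟩ := exists_eq_childCopy hq c h1
    refine ⟨_, ⟨?_, ht⟩, h2⟩
    simp only [α]
    cases copySite? q c <;> simp
  have hfin : ∀ l, (({some l, none} : Set (Option {x : G // x ≠ 1})) ×ˢ T).Finite :=
    fun l => (Set.toFinite _).prod hq.finite
  refine quasiIsometricGraphs_wordGraph_of_infinite (N := 2 * T.ncard)
    (R := (SimpleGraph.mulCayley S).dist 1 x₀) hA Subtype.val hdepth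
    (by simp [copyPar, hq.map_one]) rfl α ?_ ?_ ?_ ?_
  · intro c hc
    by_cases h : copySite q c = 1
    · simp [α, copySite?, h]
    · simp [α, copySite?, h]
  · exact fun v l => ((hfin l).image _).subset (hsub v l)
  · intro v l
    refine (Set.ncard_le_ncard (hsub v l) ((hfin l).image _)).trans
      ((Set.ncard_image_le (hfin l)).trans ?_)
    rw [Set.ncard_prod, Set.ncard_pair (by simp)]
  · intro v l
    exact ⟨(v.1, (l, ⟨k, hk1⟩) :: v.2), by simp, copyPar_cons hk v l, by
      simp only [α, copySite?_cons (k := ⟨k, hk1⟩) hk v l]; rfl⟩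

/-- Three elements of `G` give two sites other than `1`, hence two children of every copy. -/
theorem freeProductTree_quasiIsometricGraphs_of_finite [Finite G] (hG : 3 ≤ ENat.card G)
    (hS : Subgroup.closure S = ⊤) (hq : IsCayleyTree q T) :
    QuasiIsometricGraphs (freeProductTree S q)
      (wordGraph (⊥ : SimpleGraph Unit) () fun _ : Bool => ()) := by
  classical
  have hA := mulCayley_connected_of_closure_eq_top S hS
  obtain ⟨d, hd⟩ := hq.exists_depth
  obtain ⟨depth, hdepth⟩ := exists_copy_depth (G := G) hd
  obtain ⟨k, hk1, hk⟩ := hq.exists_child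
  obtain ⟨x, y, hxy⟩ : ∃ x y : {x : G // x ≠ 1}, x ≠ y := by
    have : Fintype G := Fintype.ofFinite G
    have h3 : 2 < Fintype.card G := by
      rw [ENat.card_eq_coe_fintype_card] at hG
      have : 3 ≤ Fintype.card G := by exact_mod_cast hG
      omega
    obtain ⟨x, hx⟩ : ∃ x : G, x ∉ ({1} : Finset G) :=
      Finset.exists_mem_notMem_of_card_lt_card (s := {1}) (t := Finset.univ)
        (by simpa [Finset.card_univ] using by omega) |>.imp fun _ h => h.2
    obtain ⟨y, hy⟩ : ∃ y : G, y ∉ ({1, x} : Finset G) :=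
      Finset.exists_mem_notMem_of_card_lt_card (s := {1, x}) (t := Finset.univ)
        (lt_of_le_of_lt Finset.card_le_two (by simpa [Finset.card_univ] using h3))
        |>.imp fun _ h => h.2
    simp only [Finset.mem_insert, Finset.mem_singleton, not_or] at hx hy
    exact ⟨⟨x, hx⟩, ⟨y, hy.1⟩, fun h => hy.2 (congrArg Subtype.val h).symm⟩
  have hsub : ∀ v, {c | c ≠ (1, []) ∧ copyPar q c = v} ⊆
      childCopy v '' ((Set.univ : Set (Option {x : G // x ≠ 1})) ×ˢ T) := by
    rintro v c ⟨h1, rfl⟩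
    obtain ⟨t, ht, h2⟩ := exists_eq_childCopy hq c h1
    exact ⟨_, ⟨Set.mem_univ _, ht⟩, h2⟩
  have hfin : ((Set.univ : Set (Option {x : G // x ≠ 1})) ×ˢ T).Finite :=
    (Set.toFinite _).prod hq.finite
  refine quasiIsometricGraphs_wordGraph_of_finite
    (N := ((Set.univ : Set (Option {x : G // x ≠ 1})) ×ˢ T).ncard) hA hdepth
    (by simp [copyPar, hq.map_one]) ?_ ?_ ?_
  · exact fun v => (hfin.image _).subset (hsub v)
  · intro v
    have h2 : ({(v.1, (x, ⟨k, hk1⟩) :: v.2), (v.1, (y, ⟨k, hk1⟩) :: v.2)} :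
        Set (CopyIndex G H)) ⊆ {c | c ≠ (1, []) ∧ copyPar q c = v} := by
      rintro c (rfl | rfl)
      · exact ⟨by simp, copyPar_cons hk v x⟩
      · exact ⟨by simp, copyPar_cons hk v y⟩
    have h3 := Set.ncard_le_ncard h2 ((hfin.image _).subset (hsub v))
    rwa [Set.ncard_pair (by simpa using hxy)] at h3
  · intro v
    exact (Set.ncard_le_ncard (hsub v) (hfin.image _)).trans (Set.ncard_image_le hfin)

end FreeProductTree

/-! ### Normal forms, and the Cayley graph of the free product. -/

section FreeProductAction

variable {G H : Type*} [Group G] [Group H]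

/-- The element of the free product given by a reduced word. -/
def copyEval : CopyIndex G H → Monoid.Coprod G H
  | (h, l) => Monoid.Coprod.inr h *
      (l.reverse.map fun y => Monoid.Coprod.inl (y.1 : G) * Monoid.Coprod.inr (y.2 : H)).prod

/-- The element of the free product represented by a vertex of the tree of copies. -/
def wordEval (v : CopyIndex G H × G) : Monoid.Coprod G H := copyEval v.1 * Monoid.Coprod.inl v.2

theorem copyEval_nil (h : H) :
    copyEval ((h, []) : CopyIndex G H) = (Monoid.Coprod.inr h : Monoid.Coprod G H) := by
  simp [copyEval]

theorem copyEval_cons (w : CopyIndex G H) (x : {x : G // x ≠ 1}) (k : {h : H // h ≠ 1}) :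
    copyEval ((w.1, (x, k) :: w.2) : CopyIndex G H) =
      copyEval w * Monoid.Coprod.inl (x : G) * Monoid.Coprod.inr (k : H) := by
  simp [copyEval, mul_assoc]

theorem wordEval_line (u : Option (CopyIndex G H × {x : G // x ≠ 1})) (k : H) :
    wordEval (line u k) = wordEval (line u 1) * Monoid.Coprod.inr k := by
  rcases u with _ | ⟨w, x⟩
  · simp [line_none, wordEval, copyEval_nil]
  · by_cases hk : k = 1
    · simp [hk]
    · have := line_some_coe w x ⟨k, hk⟩
      simp only at this
      rw [this, line_some_one, wordEval, wordEval, copyEval_cons]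
      simp

/-- The permutation of the vertices given by right multiplication with `g⁻¹`. -/
def leftPerm : G →* Equiv.Perm (CopyIndex G H × G) where
  toFun g := (Equiv.refl _).prodCongr (Equiv.mulRight g⁻¹)
  map_one' := by ext v <;> simp
  map_mul' g g' := by ext v <;> simp [mul_assoc]

/-- The vertices are partitioned into the cosets of `H`. -/
noncomputable def lineEquiv :
    Option (CopyIndex G H × {x : G // x ≠ 1}) × H ≃ CopyIndex G H × G where
  toFun y := line y.1 y.2
  invFun := toLine
  left_inv y := toLine_line y.1 y.2
  right_inv := line_toLine

/-- The permutation of the vertices given by right multiplication with `h⁻¹`. -/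
noncomputable def rightPerm : H →* Equiv.Perm (CopyIndex G H × G) where
  toFun h := lineEquiv.permCongr ((Equiv.refl _).prodCongr (Equiv.mulRight h⁻¹))
  map_one' := by ext v <;> simp [Equiv.permCongr_apply]
  map_mul' h h' := Equiv.ext fun v => by simp [Equiv.permCongr_apply, Prod.map, mul_assoc]

/-- The action of the free product on the vertices of its tree of copies by inverse right
multiplication. -/
noncomputable def wordPerm : Monoid.Coprod G H →* Equiv.Perm (CopyIndex G H × G) :=
  Monoid.Coprod.lift leftPerm rightPerm

theorem wordPerm_inl (g : G) (v : CopyIndex G H × G) :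
    wordPerm (Monoid.Coprod.inl g) v = (v.1, v.2 * g⁻¹) := by
  simp [wordPerm, leftPerm, Prod.map]

theorem wordPerm_inr (h : H) (u : Option (CopyIndex G H × {x : G // x ≠ 1})) (k : H) :
    wordPerm (Monoid.Coprod.inr h) (line u k) = line u (k * h⁻¹) := by
  have : lineEquiv.symm (line u k) = (u, k) := toLine_line u k
  simp [wordPerm, rightPerm, Equiv.permCongr_apply, this]
  rfl

/-- Van der Waerden's trick: letting the free product act on reduced words shows that each element
has a unique normal form, so that `wordEval` and `toVertex` are inverse to each other. -/
theorem wordEval_wordPerm (γ : Monoid.Coprod G H) (v : CopyIndex G H × G) :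
    wordEval (wordPerm γ v) = wordEval v * γ⁻¹ := by
  induction γ using Monoid.Coprod.induction_on generalizing v with
  | inl g => simp [wordPerm_inl, wordEval, mul_assoc]
  | inr h =>
    induction v using line_cases with
    | h u k => rw [wordPerm_inr, wordEval_line, wordEval_line u k]; simp [mul_assoc]
  | mul x y hx hy => rw [map_mul, Equiv.Perm.mul_apply, hx, hy]; simp [mul_assoc]

theorem wordPerm_wordEval (v : CopyIndex G H × G) : wordPerm (wordEval v) v = ((1, []), 1) := by
  obtain ⟨⟨h, l⟩, x⟩ := v
  induction l generalizing x with
  | nil =>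
    rw [wordEval, map_mul, Equiv.Perm.mul_apply, wordPerm_inl, copyEval_nil]
    have := wordPerm_inr (G := G) h none h
    simpa [line_none] using this
  | cons y l ih =>
    obtain ⟨x', k⟩ := y
    rw [wordEval, map_mul, Equiv.Perm.mul_apply, wordPerm_inl, copyEval_cons (h, l), map_mul,
      Equiv.Perm.mul_apply]
    have := wordPerm_inr (k : H) (some ((h, l), x')) (k : H)
    rw [line_some_coe, mul_inv_cancel, line_some_one] at this
    simp only [mul_inv_cancel]
    rw [this]
    exact ih x'

/-- The vertex of the tree of copies representing an element of the free product. -/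
noncomputable def toVertex (γ : Monoid.Coprod G H) : CopyIndex G H × G :=
  wordPerm γ⁻¹ ((1, []), 1)

theorem toVertex_mul (γ δ : Monoid.Coprod G H) :
    toVertex (γ * δ) = wordPerm δ⁻¹ (toVertex γ) := by
  simp [toVertex]

theorem wordEval_toVertex (γ : Monoid.Coprod G H) : wordEval (toVertex γ) = γ := by
  rw [toVertex, wordEval_wordPerm]
  simp [wordEval, copyEval]

theorem toVertex_wordEval (v : CopyIndex G H × G) : toVertex (wordEval v) = v := by
  rw [toVertex, ← wordPerm_wordEval v, ← Equiv.Perm.mul_apply, ← map_mul]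
  simp

variable {S : Set G} {q : H → H} {T : Set H}

theorem dist_wordPerm_inl_le (w : CopyIndex G H × G) {s : G} (hs : s ∈ S) :
    (freeProductTree S q).dist w (wordPerm (Monoid.Coprod.inl s)⁻¹ w) ≤ 1 := by
  rw [← map_inv, wordPerm_inl, inv_inv]
  rcases mulCayley_adj_or_eq S w.2 s hs with h | h
  · exact dist_le_one_of_adj_or_eq (Or.inl (treeGraph_adj_fiber _ h))
  · rw [← h]; simp

theorem exists_dist_wordPerm_inr_le (hS : Subgroup.closure S = ⊤) (hq : IsCayleyTree q T) :
    ∃ K, ∀ v, ∀ t ∈ T,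
      (freeProductTree S q).dist v (wordPerm (Monoid.Coprod.inr t)⁻¹ v) ≤ K := by
  obtain ⟨K, hK⟩ := hq.exists_bound
  refine ⟨K, fun v t ht => ?_⟩
  induction v using line_cases with
  | h u k =>
    rw [← map_inv, wordPerm_inr, inv_inv]
    exact (dist_line_le hS hq u k (k * t)).trans (hK k t ht)

theorem closure_inl_union_inr (hS : Subgroup.closure S = ⊤) (hT : Subgroup.closure T = ⊤) :
    Subgroup.closure ((Monoid.Coprod.inl '' S ∪ Monoid.Coprod.inr '' T :
      Set (Monoid.Coprod G H))) = ⊤ := by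
  rw [Subgroup.closure_union, ← MonoidHom.map_closure, ← MonoidHom.map_closure, hS, hT,
    ← MonoidHom.range_eq_map, ← MonoidHom.range_eq_map, Monoid.Coprod.range_inl_sup_range_inr]

/-- Under the bijection `toVertex`, a generator from `S` moves inside a copy of `G` and one from `T`
along a coset of `H`; conversely, every parent edge is multiplication by an element of `T`. -/
theorem hasCayleyGraphQuasiIsometricTo_freeProductTree (hS : Subgroup.closure S = ⊤)
    (hSf : S.Finite) (hq : IsCayleyTree q T) :
    HasCayleyGraphQuasiIsometricTo (Monoid.Coprod G H) (freeProductTree S q) := by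
  have hcl := closure_inl_union_inr hS hq.closure_eq_top
  have hc := mulCayley_connected_of_closure_eq_top _ hcl
  obtain ⟨K, hK⟩ := exists_dist_wordPerm_inr_le hS hq
  refine ⟨_, (hSf.image _).union (hq.finite.image _), hcl, hc, freeProductTree_connected hS hq,
    toVertex, wordEval, K + 1, ?_, ?_, fun γ => by simp [wordEval_toVertex], fun v => by
      simp [toVertex_wordEval]⟩
  · refine mulCayley_adj_induction (fun x y h => ?_) ?_
    · rwa [SimpleGraph.dist_comm]
    · rintro γ _ (⟨s, hs, rfl⟩ | ⟨t, ht, rfl⟩)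
      · rw [toVertex_mul]
        exact (dist_wordPerm_inl_le _ hs).trans (by omega)
      · rw [toVertex_mul]
        exact (hK _ t ht).trans (by omega)
  · refine treeGraph_adj_induction (fun x y h => ?_) ?_ fun c => ?_
    · rwa [SimpleGraph.dist_comm]
    · intro w p p' h
      refine mulCayley_adj_induction (r := fun p p' => (SimpleGraph.mulCayley _).dist
        (wordEval (w, p)) (wordEval (w, p')) ≤ K + 1) (fun x y h => ?_) (fun a s hs => ?_) p p' h
      · rwa [SimpleGraph.dist_comm]
      · have : wordEval (w, a * s) = wordEval (w, a) * Monoid.Coprod.inl s := by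
          simp [wordEval, mul_assoc]
        rw [this]
        exact le_trans (b := 1) (dist_le_one_of_adj_or_eq
          (mulCayley_adj_or_eq _ _ _ (Or.inl ⟨s, hs, rfl⟩))) (by omega)
    · obtain ⟨u, k, h1, h2⟩ := exists_line_base q c
      rw [← h1, ← h2]
      by_cases hk : k = 1
      · simp [hk, hq.map_one]
      · obtain ⟨t, ht, h3⟩ := hq.exists_step k hk
        have : wordEval (line u k) = wordEval (line u (q k)) * Monoid.Coprod.inr t := by
          rw [wordEval_line, wordEval_line u (q k), mul_assoc, ← map_mul, h3]
        rw [this, SimpleGraph.dist_comm]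
        exact le_trans (b := 1) (dist_le_one_of_adj_or_eq
          (mulCayley_adj_or_eq _ _ _ (Or.inr ⟨t, ht, rfl⟩))) (by omega)

end FreeProductAction

/-! ### Free products of conjugates of `G` as kernels of finite index. -/

section KernelOfProjection

variable {G C N : Type*} [Group G] [Group C] [Group N]

/-- The image in `C` of a vertex under the projection of the free product of `G` and `C` onto `C`. -/
def copyTotal (w : CopyIndex G C) : C := w.1 * (w.2.reverse.map fun y => (y.2 : C)).prod

/-- The image of the base point of a copy under the retraction of the free product of `G` and `C`
onto a free product of copies of `G` indexed by `C`. -/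
def copyProj (n : C → G →* N) (h : C) : List ({x : G // x ≠ 1} × {h : C // h ≠ 1}) → N
  | [] => 1
  | (x, _) :: l => copyProj n h l * n (copyTotal (h, l)) x

/-- The image of a vertex under the retraction of the free product of `G` and `C` onto a free
product of copies of `G` indexed by `C`. -/
def wordProj (n : C → G →* N) (v : CopyIndex G C × G) : N :=
  copyProj n v.1.1 v.1.2 * n (copyTotal v.1) v.2

variable (n : C → G →* N)

theorem copyTotal_cons (w : CopyIndex G C) (x : {x : G // x ≠ 1}) (k : {h : C // h ≠ 1}) :
    copyTotal ((w.1, (x, k) :: w.2) : CopyIndex G C) = copyTotal w * k := by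
  simp [copyTotal, mul_assoc]

theorem copyTotal_line (u : Option (CopyIndex G C × {x : G // x ≠ 1})) (k : C) :
    copyTotal (line u k).1 = copyTotal (line u 1).1 * k := by
  rcases u with _ | ⟨w, x⟩
  · simp [line_none, copyTotal]
  · by_cases hk : k = 1
    · simp [hk]
    · have := line_some_coe w x ⟨k, hk⟩
      simp only at this
      rw [this, line_some_one, copyTotal_cons]

theorem wordProj_line (u : Option (CopyIndex G C × {x : G // x ≠ 1})) (k : C) :
    wordProj n (line u k) = wordProj n (line u 1) := by
  rcases u with _ | ⟨w, x⟩
  · simp [line_none, wordProj, copyProj]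
  · by_cases hk : k = 1
    · simp [hk]
    · have := line_some_coe w x ⟨k, hk⟩
      simp only at this
      rw [this, line_some_one]
      simp [wordProj, copyProj]

theorem wordProj_wordPerm_inl (g : G) (v : CopyIndex G C × G) :
    wordProj n (wordPerm (Monoid.Coprod.inl g) v) =
      wordProj n v * (n (copyTotal v.1) g)⁻¹ := by
  simp [wordPerm_inl, wordProj, mul_assoc]

theorem copyTotal_wordPerm_inl (g : G) (v : CopyIndex G C × G) :
    copyTotal (wordPerm (Monoid.Coprod.inl g) v).1 = copyTotal v.1 := by
  simp [wordPerm_inl]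

theorem wordProj_wordPerm_inr (h : C) (v : CopyIndex G C × G) :
    wordProj n (wordPerm (Monoid.Coprod.inr h) v) = wordProj n v := by
  induction v using line_cases with
  | h u k => rw [wordPerm_inr, wordProj_line, wordProj_line n u k]

theorem copyTotal_wordPerm_inr (h : C) (v : CopyIndex G C × G) :
    copyTotal (wordPerm (Monoid.Coprod.inr h) v).1 = copyTotal v.1 * h⁻¹ := by
  induction v using line_cases with
  | h u k => rw [wordPerm_inr, copyTotal_line, copyTotal_line u k, mul_assoc]

variable {n} {ι : N →* Monoid.Coprod G C}

/-- At total `1`, acting by a conjugate of `g` by `c` shifts the total to `c`, multiplies the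
projection by `(n c g)⁻¹`, and shifts back. Since such elements generate `N`, the projection inverts
`ι`, and no structure of `N` as a free product is needed. -/
theorem wordProj_wordPerm (hn : ⨆ c, (n c).range = ⊤)
    (hι : ∀ c g, ι (n c g) = Monoid.Coprod.inr c * Monoid.Coprod.inl g * (Monoid.Coprod.inr c)⁻¹)
    (γ : N) (v : CopyIndex G C × G) (hv : copyTotal v.1 = 1) :
    wordProj n (wordPerm (ι γ) v) = wordProj n v * γ⁻¹ ∧ copyTotal (wordPerm (ι γ) v).1 = 1 := by
  have hγ : γ ∈ ⨆ c, (n c).range := hn ▸ Subgroup.mem_top γ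
  refine Subgroup.iSup_induction (fun c => (n c).range) (C := fun γ => ∀ v : CopyIndex G C × G,
    copyTotal v.1 = 1 → wordProj n (wordPerm (ι γ) v) = wordProj n v * γ⁻¹ ∧
      copyTotal (wordPerm (ι γ) v).1 = 1) hγ ?_ (fun v hv => by simp [hv]) ?_ v hv
  · rintro c _ ⟨g, rfl⟩ v hv
    rw [hι, ← map_inv]
    simp only [map_mul wordPerm, Equiv.Perm.mul_apply, wordProj_wordPerm_inr,
      copyTotal_wordPerm_inr, wordProj_wordPerm_inl, copyTotal_wordPerm_inl, hv]
    simp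
  · intro x y hx hy v hv
    obtain ⟨h1, h2⟩ := hy v hv
    obtain ⟨h3, h4⟩ := hx _ h2
    rw [map_mul, map_mul, Equiv.Perm.mul_apply, h3, h1]
    exact ⟨by simp [mul_assoc], h4⟩

theorem wordProj_toVertex (hn : ⨆ c, (n c).range = ⊤)
    (hι : ∀ c g, ι (n c g) = Monoid.Coprod.inr c * Monoid.Coprod.inl g * (Monoid.Coprod.inr c)⁻¹)
    (γ : N) : wordProj n (toVertex (ι γ)) = γ := by
  rw [toVertex, ← map_inv, (wordProj_wordPerm hn hι γ⁻¹ _ (by simp [copyTotal])).1]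
  simp [wordProj, copyProj]

/-- Moving all letters from `C` to the right conjugates the letters from `G`: this is the semidirect
decomposition of the free product over `C`. For finite `C` the remaining factor is bounded, so `ι`
is coarsely onto. -/
theorem map_wordProj
    (hι : ∀ c g, ι (n c g) = Monoid.Coprod.inr c * Monoid.Coprod.inl g * (Monoid.Coprod.inr c)⁻¹)
    (v : CopyIndex G C × G) :
    ι (wordProj n v) = wordEval v * (Monoid.Coprod.inr (copyTotal v.1))⁻¹ := by
  obtain ⟨⟨h, l⟩, x⟩ := v
  induction l generalizing x with
  | nil => simp [wordProj, copyProj, hι, wordEval, copyEval_nil, copyTotal]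
  | cons y l ih =>
    obtain ⟨x', k⟩ := y
    have h1 : wordProj n ((h, (x', k) :: l), x) =
        wordProj n ((h, l), (x' : G)) * n (copyTotal ((h, l) : CopyIndex G C) * k) x := by
      rw [← copyTotal_cons]; rfl
    rw [h1, map_mul, ih, hι, copyTotal_cons (h, l), wordEval, wordEval, copyEval_cons (h, l)]
    simp [mul_assoc]

/-- The star centred at `1` has diameter at most `2`. -/
theorem isCayleyTree_of_finite [Finite C] [Nontrivial C] :
    IsCayleyTree (fun _ : C => 1) Set.univ := by
  classical
  have hd : ∀ h : C, h ≠ 1 → (if (1 : C) = 1 then 0 else 1) < if h = 1 then 0 else 1 := by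
    intro h hh
    simp [hh]
  refine ⟨rfl, ⟨fun h => if h = 1 then 0 else 1, hd⟩, fun h _ => ⟨h, trivial, by simp⟩,
    Set.finite_univ, by simp, (exists_ne 1).imp fun h hh => ⟨hh, rfl⟩, 2, fun k t _ => ?_⟩
  have hT : (retractionTree fun _ : C => 1).Connected :=
    treeGraph_connected (depth := fun h => if h = 1 then 0 else 1) ⟨fun _ _ => .refl _⟩ hd
  have key : ∀ k : C, (retractionTree fun _ : C => 1).dist (k, ()) (1, ()) ≤ 1 :=
    fun k => treeGraph_dist_parent_le k
  have h1 := key k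
  have h2 := key (k * t)
  rw [SimpleGraph.dist_comm] at h2
  exact hT.dist_triangle.trans (Nat.add_le_add h1 h2)

/-- The free product of copies of `G` indexed by the elements of a finite group `C` is the kernel of
the projection of the free product of `G` and `C` onto `C`, and quasi-isometric to it. -/
theorem hasCayleyGraphQuasiIsometricTo_of_conjugates [Finite C] [Nontrivial C] {S : Set G}
    (hS : Subgroup.closure S = ⊤) (hSf : S.Finite) (hn : ⨆ c, (n c).range = ⊤)
    (hι : ∀ c g, ι (n c g) = Monoid.Coprod.inr c * Monoid.Coprod.inl g * (Monoid.Coprod.inr c)⁻¹) :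
    HasCayleyGraphQuasiIsometricTo N (freeProductTree S fun _ : C => 1) := by
  have hq := isCayleyTree_of_finite (C := C)
  have hX := freeProductTree_connected hS hq
  have hcl : Subgroup.closure (⋃ c, n c '' S) = ⊤ := by
    simp_rw [Subgroup.closure_iUnion, ← MonoidHom.map_closure, hS, ← MonoidHom.range_eq_map]
    exact hn
  obtain ⟨K, hK⟩ := exists_dist_wordPerm_inr_le hS hq
  refine ⟨_, Set.finite_iUnion fun c => hSf.image (n c), hcl,
    mulCayley_connected_of_closure_eq_top _ hcl, hX, fun γ => toVertex (ι γ), wordProj n,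
    2 * K + 1, ?_, ?_, fun γ => by simp [wordProj_toVertex hn hι], fun v => ?_⟩
  · refine mulCayley_adj_induction (fun x y h => ?_) ?_
    · rwa [SimpleGraph.dist_comm]
    · intro γ _ hγ
      obtain ⟨c, s, hs, rfl⟩ := Set.mem_iUnion.1 hγ
      -- A conjugate generator is three moves, costing `K`, `1` and `K`.
      have h0 : (ι (n c s))⁻¹ = (Monoid.Coprod.inr c⁻¹)⁻¹ *
          ((Monoid.Coprod.inl s)⁻¹ * (Monoid.Coprod.inr c)⁻¹) := by
        rw [hι]; simp [mul_assoc]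
      simp only [map_mul ι, toVertex_mul]
      rw [h0, map_mul wordPerm, map_mul wordPerm, Equiv.Perm.mul_apply, Equiv.Perm.mul_apply]
      have h1 := hK (toVertex (ι γ)) c trivial
      set v₁ := wordPerm (Monoid.Coprod.inr c)⁻¹ (toVertex (ι γ))
      have h2 := dist_wordPerm_inl_le (q := fun _ : C => 1) v₁ hs
      set v₂ := wordPerm (Monoid.Coprod.inl s)⁻¹ v₁
      have h3 := hK v₂ c⁻¹ trivial
      set v₃ := wordPerm (Monoid.Coprod.inr c⁻¹)⁻¹ v₂
      have h4 := hX.dist_triangle (u := toVertex (ι γ)) (v := v₁) (w := v₃)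
      have h5 := hX.dist_triangle (u := v₁) (v := v₂) (w := v₃)
      omega
  · refine treeGraph_adj_induction (fun x y h => ?_) ?_ fun c => ?_
    · rwa [SimpleGraph.dist_comm]
    · intro w p p' h
      refine mulCayley_adj_induction (r := fun p p' => (SimpleGraph.mulCayley _).dist
        (wordProj n (w, p)) (wordProj n (w, p')) ≤ 2 * K + 1) (fun x y h => ?_)
        (fun a s hs => ?_) p p' h
      · rwa [SimpleGraph.dist_comm]
      · have : wordProj n (w, a * s) = wordProj n (w, a) * n (copyTotal w) s := by
          simp [wordProj, mul_assoc]
        rw [this]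
        exact le_trans (b := 1) (dist_le_one_of_adj_or_eq
          (mulCayley_adj_or_eq _ _ _ (Set.mem_iUnion.2 ⟨_, s, hs, rfl⟩))) (by omega)
    -- A parent edge lies on a coset of `C`, where the projection is constant, so it collapses.
    · obtain ⟨u, k, h1, h2⟩ := exists_line_base (fun _ : C => 1) c
      rw [← h1, ← h2, wordProj_line n u k]
      simp
  · have h1 : toVertex (ι (wordProj n v)) =
        wordPerm (Monoid.Coprod.inr (copyTotal v.1)⁻¹)⁻¹ v := by
      rw [map_wordProj hι, toVertex_mul, toVertex_wordEval]
      simp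
    simp only [h1]
    rw [ SimpleGraph.dist_comm]
    exact (hK v _ trivial).trans (by omega)

end KernelOfProjection

/-! ### The integers as a tree rooted at zero. -/

section Integers

/-- The map moving every integer one step towards zero, in multiplicative notation. -/
def towardsZero (m : Multiplicative ℤ) : Multiplicative ℤ :=
  Multiplicative.ofAdd (Multiplicative.toAdd m - (Multiplicative.toAdd m).sign)

theorem isCayleyTree_towardsZero :
    IsCayleyTree towardsZero {Multiplicative.ofAdd (1 : ℤ), Multiplicative.ofAdd (-1 : ℤ)} := by
  have hpos : ∀ m : ℤ, 0 < m → towardsZero (.ofAdd m) = .ofAdd (m - 1) := fun m hm => by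
    simp [towardsZero, Int.sign_eq_one_of_pos hm]
  have hneg : ∀ m : ℤ, m < 0 → towardsZero (.ofAdd m) = .ofAdd (m + 1) := fun m hm => by
    simp [towardsZero, Int.sign_eq_neg_one_of_neg hm]
  have hadj : ∀ m : ℤ, (retractionTree towardsZero).dist
      (Multiplicative.ofAdd m, ()) (Multiplicative.ofAdd (m + 1), ()) ≤ 1 := by
    intro m
    by_cases hm : m < 0
    · have := treeGraph_dist_parent_le (A := (⊥ : SimpleGraph Unit)) (b := ())
        (par := towardsZero) (site := fun _ => ()) (Multiplicative.ofAdd m)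
      rwa [hneg m hm] at this
    · have := treeGraph_dist_parent_le (A := (⊥ : SimpleGraph Unit)) (b := ())
        (par := towardsZero) (site := fun _ => ()) (Multiplicative.ofAdd (m + 1))
      rw [hpos (m + 1) (by omega), add_sub_cancel_right, SimpleGraph.dist_comm] at this
      exact this
  refine ⟨rfl, ⟨fun m => (Multiplicative.toAdd m).natAbs, ?_⟩, ?_, by simp, ?_,
    ⟨Multiplicative.ofAdd 1, by decide, rfl⟩, 1, ?_⟩
  · intro m
    induction m using Multiplicative.rec with
    | ofAdd m =>
      intro hm
      have hm' : m ≠ 0 := fun e => hm (by rw [e]; rfl)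
      rcases lt_or_gt_of_ne hm' with h | h
      · rw [hneg m h]; simp only [toAdd_ofAdd]; omega
      · rw [hpos m h]; simp only [toAdd_ofAdd]; omega
  · intro m
    induction m using Multiplicative.rec with
    | ofAdd m =>
      intro hm
      have hm' : m ≠ 0 := fun e => hm (by rw [e]; rfl)
      rcases lt_or_gt_of_ne hm' with h | h
      · exact ⟨_, Or.inr rfl, by rw [hneg m h, ← ofAdd_add]; simp⟩
      · exact ⟨_, Or.inl rfl, by rw [hpos m h, ← ofAdd_add]; simp⟩
  · rw [Subgroup.eq_top_iff']
    intro m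
    have h1 : Multiplicative.ofAdd (1 : ℤ) ∈ Subgroup.closure
        ({Multiplicative.ofAdd (1 : ℤ), Multiplicative.ofAdd (-1 : ℤ)} : Set _) :=
      Subgroup.subset_closure (Or.inl rfl)
    have h2 := Subgroup.zpow_mem _ h1 (Multiplicative.toAdd m)
    rwa [← ofAdd_zsmul, smul_eq_mul, mul_one, ofAdd_toAdd] at h2
  · intro m t ht
    induction m using Multiplicative.rec with
    | ofAdd m =>
      rcases ht with rfl | rfl
      · exact hadj m
      · rw [← ofAdd_add, SimpleGraph.dist_comm]
        have := hadj (m + -1)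
        rwa [neg_add_cancel_right] at this

end Integers

/-! ### The four free products. -/

section Main

variable {G : Type*} [Group G]

/-- The embedding of `G` into its free product with `C`, followed by conjugation with `c`. -/
def conjInl {C : Type*} [Group C] (c : C) : G →* Monoid.Coprod G C :=
  (MulAut.conj (Monoid.Coprod.inr c)).toMonoidHom.comp Monoid.Coprod.inl

theorem conjInl_apply {C : Type*} [Group C] (c : C) (g : G) :
    conjInl c g = Monoid.Coprod.inr c * Monoid.Coprod.inl g * (Monoid.Coprod.inr c)⁻¹ := rfl

/-- The two factors map to `G` and its conjugate by the generator `t` of `ℤ/2`. -/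
theorem hasCayleyGraphQuasiIsometricTo_coprod_self {S : Set G} (hS : Subgroup.closure S = ⊤)
    (hSf : S.Finite) : HasCayleyGraphQuasiIsometricTo (Monoid.Coprod G G)
      (freeProductTree S fun _ : Multiplicative (ZMod 2) => 1) := by
  let t : Multiplicative (ZMod 2) := .ofAdd 1
  let n : Multiplicative (ZMod 2) → G →* Monoid.Coprod G G := fun c =>
    if c = 1 then Monoid.Coprod.inl else Monoid.Coprod.inr
  have hcases : ∀ c : Multiplicative (ZMod 2), c = 1 ∨ c = t := by decide
  have ht : t ≠ 1 := by decide
  refine hasCayleyGraphQuasiIsometricTo_of_conjugates hS hSf (n := n)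
    (ι := Monoid.Coprod.lift (conjInl 1) (conjInl t)) ?_ ?_
  · rw [eq_top_iff, ← Monoid.Coprod.range_inl_sup_range_inr]
    refine sup_le ?_ ?_
    · exact le_iSup_of_le 1 (by simp [n])
    · exact le_iSup_of_le t (by simp [n, ht])
  · intro c g
    rcases hcases c with rfl | rfl
    · simp [n, conjInl_apply]
    · simp [n, conjInl_apply, ht]

theorem hasCayleyGraphQuasiIsometricTo_coprod_coprod_self {S : Set G}
    (hS : Subgroup.closure S = ⊤) (hSf : S.Finite) :
    HasCayleyGraphQuasiIsometricTo (Monoid.Coprod (Monoid.Coprod G G) G)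
      (freeProductTree S fun _ : Multiplicative (ZMod 3) => 1) := by
  let t : Multiplicative (ZMod 3) := .ofAdd 1
  let t' : Multiplicative (ZMod 3) := .ofAdd 2
  let n : Multiplicative (ZMod 3) → G →* Monoid.Coprod (Monoid.Coprod G G) G := fun c =>
    if c = 1 then Monoid.Coprod.inl.comp Monoid.Coprod.inl else
      if c = t then Monoid.Coprod.inl.comp Monoid.Coprod.inr else Monoid.Coprod.inr
  have hcases : ∀ c : Multiplicative (ZMod 3), c = 1 ∨ c = t ∨ c = t' := by decide
  have ht : t ≠ 1 := by decide
  have ht' : t' ≠ 1 := by decide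
  have htt' : t' ≠ t := by decide
  refine hasCayleyGraphQuasiIsometricTo_of_conjugates hS hSf (n := n)
    (ι := Monoid.Coprod.lift (Monoid.Coprod.lift (conjInl 1) (conjInl t)) (conjInl t')) ?_ ?_
  · rw [eq_top_iff, ← Monoid.Coprod.range_inl_sup_range_inr]
    have h : (Monoid.Coprod.inl : Monoid.Coprod G G →* Monoid.Coprod (Monoid.Coprod G G) G).range =
        (Monoid.Coprod.inl.comp Monoid.Coprod.inl).range ⊔
          (Monoid.Coprod.inl.comp Monoid.Coprod.inr).range := by
      rw [MonoidHom.range_comp, MonoidHom.range_comp, ← Subgroup.map_sup,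
        Monoid.Coprod.range_inl_sup_range_inr, ← MonoidHom.range_eq_map]
    rw [h]
    refine sup_le (sup_le ?_ ?_) ?_
    · exact le_iSup_of_le 1 (by simp [n])
    · exact le_iSup_of_le t (by simp [n, ht])
    · exact le_iSup_of_le t' (by simp [n, ht', htt'])
  · intro c g
    rcases hcases c with rfl | rfl | rfl
    · simp [n, conjInl_apply]
    · simp [n, conjInl_apply, ht]
    · simp [n, conjInl_apply, ht', htt']

/-- Both trees are compared with a model that does not involve the second factor. -/
theorem quasiIsometricGraphs_freeProductTree (hG : 3 ≤ ENat.card G) {H K : Type*} [Group H]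
    [Group K] {S : Set G} (hS : Subgroup.closure S = ⊤) {q : H → H} {T : Set H}
    (hq : IsCayleyTree q T) {q' : K → K} {T' : Set K} (hq' : IsCayleyTree q' T') :
    QuasiIsometricGraphs (freeProductTree S q) (freeProductTree S q') := by
  rcases finite_or_infinite G with h | h
  · exact (freeProductTree_quasiIsometricGraphs_of_finite hG hS hq).trans
      (freeProductTree_quasiIsometricGraphs_of_finite hG hS hq').symm
  · exact (freeProductTree_quasiIsometricGraphs_of_infinite hS hq).trans
      (freeProductTree_quasiIsometricGraphs_of_infinite hS hq').symm

end Main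

theorem mainTheorem6 (G : Type*) [Group G] (hfg : Group.FG G) (hcard : 3 ≤ ENat.card G) :
    GroupsQuasiIsometric (Monoid.Coprod G G) (Monoid.Coprod G (Multiplicative ℤ)) ∧
    GroupsQuasiIsometric (Monoid.Coprod G G) (Monoid.Coprod (Monoid.Coprod G G) G) ∧
    GroupsQuasiIsometric (Monoid.Coprod G G) (Monoid.Coprod G (Multiplicative (ZMod 2))) ∧
    GroupsQuasiIsometric (Monoid.Coprod G (Multiplicative ℤ))
      (Monoid.Coprod (Monoid.Coprod G G) G) ∧
    GroupsQuasiIsometric (Monoid.Coprod G (Multiplicative ℤ))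
      (Monoid.Coprod G (Multiplicative (ZMod 2))) ∧
    GroupsQuasiIsometric (Monoid.Coprod (Monoid.Coprod G G) G)
      (Monoid.Coprod G (Multiplicative (ZMod 2))) := by
  obtain ⟨S, hS, hSf⟩ := Group.fg_iff.1 hfg
  have : Nontrivial (Multiplicative (ZMod 2)) := ⟨1, .ofAdd 1, by decide⟩
  have : Nontrivial (Multiplicative (ZMod 3)) := ⟨1, .ofAdd 1, by decide⟩
  have q2 := isCayleyTree_of_finite (C := Multiplicative (ZMod 2))
  have q3 := isCayleyTree_of_finite (C := Multiplicative (ZMod 3))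
  -- The common model for all four groups is the tree of `G * ℤ/2`.
  have h1 := hasCayleyGraphQuasiIsometricTo_coprod_self hS hSf
  have h2 := (hasCayleyGraphQuasiIsometricTo_freeProductTree hS hSf isCayleyTree_towardsZero).trans
    (quasiIsometricGraphs_freeProductTree hcard hS isCayleyTree_towardsZero q2)
  have h3 := (hasCayleyGraphQuasiIsometricTo_coprod_coprod_self hS hSf).trans
    (quasiIsometricGraphs_freeProductTree hcard hS q3 q2)
  have h4 := hasCayleyGraphQuasiIsometricTo_freeProductTree hS hSf q2
  exact ⟨h1.groupsQuasiIsometric h2, h1.groupsQuasiIsometric h3, h1.groupsQuasiIsometric h4,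
    h2.groupsQuasiIsometric h3, h2.groupsQuasiIsometric h4, h3.groupsQuasiIsometric h4⟩
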